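/- Let $n\ge 1$ and let $D\subset\mathbb C^n$ be a bounded homogeneous domain, i.e. a bounded, non-empty, connected open set whose group of biholomorphic self-maps acts transitively; fix a base point $z_0\in D$. Let $K$ be the Bergman kernel of $D$ and let $$H_z(u,\bar v)=\tfrac12\sum_{j,k}\frac{\partial^2\log K(z,z)}{\partial z_j\,\partial\bar z_k}\,u_j\bar v_k$$ be the Bergman metric (normalised so that $H_z(u,\bar u)=|u|^2/(1-|z|^2)^2$ on the unit disk). For $f$ holomorphic on $D$ put $$Q_f(z)=\sup_{u\ne 0}\frac{|\nabla f(z)u|}{H_z(u,\bar u)^{1/2}},\qquad \beta_f=\sup_{z\in D}Q_f(z).$$ The Bloch space $\mathcal B(D)$ is the space of all holomorphic $f$ on $D$ with $\beta_f<\infty$, with norm $|f(z_0)|+\beta_f$. Let $A(D)$ be the algebra of continuous functions on $\overline D$ that are holomorphic on $D$, and let $\partial^*D$ be the distinguished (Shilov) boundary of $D$, the smallest closed subset of $\overline D$ on which every function of $A(D)$ attains its maximum modulus. The $*$-little Bloch space $\mathcal B_{0*}(D)$ is the subspace of all $f\in\mathcal B(D)$ with $Q_f(z)\to0$ as $z\to\partial^*D$.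 For a holomorphic function $\psi$ on $D$ let $M_\psi f=\psi f$. 1. $M_\psi$ is a compact operator on $\mathcal B(D)$ if and only if $\psi\equiv0$. 2. If $\mathcal B_{0*}(D)$ is infinite-dimensional, then $M_\psi$ is a compact operator on $\mathcal B_{0*}(D)$ if and only if $\psi\equiv0$. 3. $\mathcal B_{0*}(D)$ is infinite-dimensional whenever each $\zeta\in\partial^*D$ is the only zero in $\overline D$ of some function in $A(D)$. (This condition holds whenever $n=1$, and whenever every point of $\partial^*D$ is a peak point of $A(D)$, as for the ball, the polydisk and all bounded symmetric domains in their standard realization.) (That $M_\psi$ is a compact operator on a space $X$ includes that it maps $X$ into itself.) -/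

import Mathlib

open scoped Topology ENNReal ComplexConjugate
open MeasureTheory Filter

/-- `φ` restricts to a biholomorphic self-map of `D ⊆ ℂⁿ`. -/
def IsBiholomorphicSelfMap {n : ℕ} (D : Set (Fin n → ℂ)) (φ : (Fin n → ℂ) → (Fin n → ℂ)) : Prop :=
  DifferentiableOn ℂ φ D ∧ Set.MapsTo φ D D ∧
    ∃ χ : (Fin n → ℂ) → (Fin n → ℂ), DifferentiableOn ℂ χ D ∧ Set.MapsTo χ D D ∧
      (∀ z ∈ D, χ (φ z) = z) ∧ ∀ z ∈ D, φ (χ z) = z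

/-- A bounded homogeneous domain in `ℂⁿ`: a bounded, non-empty, connected open set on which the
biholomorphic self-maps act transitively. -/
structure BoundedHomogeneousDomain (n : ℕ) where
  carrier : Set (Fin n → ℂ)
  isOpen : IsOpen carrier
  isConnected : IsConnected carrier
  isBounded : Bornology.IsBounded carrier
  transitive : ∀ z ∈ carrier, ∀ w ∈ carrier, ∃ φ, IsBiholomorphicSelfMap carrier φ ∧ φ z = w

/-! ### Bergman kernel and Bergman metric -/

/-- The Bergman space: holomorphic functions on `D`, square integrable for Lebesgue measure. -/
def MemBergmanSpace {n : ℕ} (D : Set (Fin n → ℂ)) (f : (Fin n → ℂ) → ℂ) : Prop :=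
  DifferentiableOn ℂ f D ∧ MemLp f 2 (volume.restrict D)

/-- `K` is a reproducing kernel of the Bergman space of `D`. -/
def IsBergmanKernel {n : ℕ} (D : Set (Fin n → ℂ))
    (K : (Fin n → ℂ) → (Fin n → ℂ) → ℂ) : Prop :=
  ∀ w ∈ D, MemBergmanSpace D (fun z => K z w) ∧
    ∀ f, MemBergmanSpace D f → f w = ∫ z in D, f z * conj (K z w)

open Classical in
/-- The Bergman kernel of `D`. It exists and is unique on `D × D` for every open set `D`
(by Riesz representation); only its values on `D × D` are used. -/
noncomputable def bergmanKernel {n : ℕ} (D : Set (Fin n → ℂ)) :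
    (Fin n → ℂ) → (Fin n → ℂ) → ℂ :=
  if h : ∃ K, IsBergmanKernel D K then h.choose else 0

/-- The Wirtinger derivative `∂/∂z_j`. -/
noncomputable def wirtingerD {n : ℕ} (j : Fin n) (F : (Fin n → ℂ) → ℂ) (z : Fin n → ℂ) : ℂ :=
  (1 / 2) * (fderiv ℝ F z (Pi.single j 1) - Complex.I * fderiv ℝ F z (Pi.single j Complex.I))

/-- The Wirtinger derivative `∂/∂z̄_j`. -/
noncomputable def wirtingerDBar {n : ℕ} (j : Fin n) (F : (Fin n → ℂ) → ℂ) (z : Fin n → ℂ) : ℂ :=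
  (1 / 2) * (fderiv ℝ F z (Pi.single j 1) + Complex.I * fderiv ℝ F z (Pi.single j Complex.I))

/-- `H_z(u, v̄) = ½ ∑ ∂² log K(z,z) / ∂z_j ∂z̄_k · u_j · conj v_k`, the Bergman metric, normalised
so that it is `|u|² / (1 - |z|²)²` on the unit disk. -/
noncomputable def bergmanMetric {n : ℕ} (D : Set (Fin n → ℂ)) (z u v : Fin n → ℂ) : ℂ :=
  (1 / 2) * ∑ j, ∑ k,
    wirtingerD j (wirtingerDBar k fun w => (Real.log (bergmanKernel D w w).re : ℂ)) z
      * u j * conj (v k)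

/-! ### The distinguished boundary -/

/-- The algebra `A(D)`: continuous on the closure of `D` and holomorphic on `D`. -/
def MemDiskAlgebra {n : ℕ} (D : Set (Fin n → ℂ)) (h : (Fin n → ℂ) → ℂ) : Prop :=
  ContinuousOn h (closure D) ∧ DifferentiableOn ℂ h D

/-- `S` is a closed subset of the closure of `D` on which every function of `A(D)` attains its
maximum modulus. -/
def IsMaximumModulusSet {n : ℕ} (D S : Set (Fin n → ℂ)) : Prop :=
  IsClosed S ∧ S ⊆ closure D ∧
    ∀ h, MemDiskAlgebra D h → ∃ s ∈ S, ∀ z ∈ closure D, ‖h z‖ ≤ ‖h s‖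

/-- The distinguished (Shilov) boundary of `D`: the smallest closed set on which every function of
`A(D)` attains its maximum modulus. -/
def distinguishedBoundary {n : ℕ} (D : Set (Fin n → ℂ)) : Set (Fin n → ℂ) :=
  ⋂₀ {S | IsMaximumModulusSet D S}

namespace BoundedHomogeneousDomain

variable {n : ℕ} (D : BoundedHomogeneousDomain n)

/-- Extension by zero of a function on `D` to `ℂⁿ`, so that derivatives at points of the open set
`D` can be taken in `ℂⁿ`. -/
noncomputable def extend (f : D.carrier → ℂ) : (Fin n → ℂ) → ℂ :=
  Function.extend Subtype.val f 0

/-- `f ∈ H(D)`. -/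
def Holo (f : D.carrier → ℂ) : Prop := DifferentiableOn ℂ (D.extend f) D.carrier

/-- `Q_f(z) = sup_{u ≠ 0} |∇f(z) u| / H_z(u, ū)^{1/2}`. -/
noncomputable def Q (f : D.carrier → ℂ) (z : Fin n → ℂ) : ℝ≥0∞ :=
  ⨆ u : Fin n → ℂ, ⨆ _ : u ≠ 0,
    ‖fderiv ℂ (D.extend f) z u‖ₑ / ENNReal.ofReal (Real.sqrt (bergmanMetric D.carrier z u u).re)

/-- `β_f = sup_{z ∈ D} Q_f(z)`. -/
noncomputable def beta (f : D.carrier → ℂ) : ℝ≥0∞ := ⨆ z ∈ D.carrier, D.Q f z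

theorem extend_apply (f : D.carrier → ℂ) (z : D.carrier) : D.extend f z = f z :=
  Subtype.val_injective.extend_apply f 0 z

theorem extend_add (f g : D.carrier → ℂ) : D.extend (f + g) = D.extend f + D.extend g := by
  have := Function.extend_add (Subtype.val : D.carrier → _) f g 0 0
  simpa [extend] using this

theorem extend_smul (c : ℂ) (f : D.carrier → ℂ) : D.extend (c • f) = c • D.extend f := by
  have := Function.extend_smul c (Subtype.val : D.carrier → _) f 0
  simpa [extend] using this

theorem extend_zero : D.extend 0 = 0 := by
  simpa using D.extend_smul 0 0

theorem holo_zero : D.Holo 0 := by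
  unfold Holo; rw [extend_zero]; exact differentiableOn_const 0

variable {D}

theorem Holo.differentiableAt {f : D.carrier → ℂ} (hf : D.Holo f) {z : Fin n → ℂ}
    (hz : z ∈ D.carrier) : DifferentiableAt ℂ (D.extend f) z :=
  (hf z hz).differentiableAt (D.isOpen.mem_nhds hz)

theorem Holo.add {f g : D.carrier → ℂ} (hf : D.Holo f) (hg : D.Holo g) : D.Holo (f + g) := by
  unfold Holo; rw [extend_add]; exact DifferentiableOn.add hf hg

theorem Holo.smul (c : ℂ) {f : D.carrier → ℂ} (hf : D.Holo f) : D.Holo (c • f) := by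
  unfold Holo; rw [extend_smul]; exact DifferentiableOn.const_smul hf c

theorem Q_zero (z : Fin n → ℂ) : D.Q 0 z = 0 := by
  have : fderiv ℂ (0 : (Fin n → ℂ) → ℂ) z = 0 := fderiv_const_apply 0
  simp [Q, extend_zero, this]

theorem Q_add_le {f g : D.carrier → ℂ} (hf : D.Holo f) (hg : D.Holo g) {z : Fin n → ℂ}
    (hz : z ∈ D.carrier) : D.Q (f + g) z ≤ D.Q f z + D.Q g z := by
  refine iSup₂_le fun u hu => ?_
  rw [extend_add, fderiv_add (hf.differentiableAt hz) (hg.differentiableAt hz)]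
  calc _ ≤ ‖fderiv ℂ (D.extend f) z u‖ₑ
              / ENNReal.ofReal (Real.sqrt (bergmanMetric D.carrier z u u).re)
            + ‖fderiv ℂ (D.extend g) z u‖ₑ
              / ENNReal.ofReal (Real.sqrt (bergmanMetric D.carrier z u u).re) := by
        rw [← ENNReal.add_div]
        exact ENNReal.div_le_div_right (enorm_add_le _ _) _
    _ ≤ _ := add_le_add
        (le_iSup₂ (f := fun (u : Fin n → ℂ) (_ : u ≠ 0) => ‖fderiv ℂ (D.extend f) z u‖ₑ
              / ENNReal.ofReal (Real.sqrt (bergmanMetric D.carrier z u u).re)) u hu)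
        (le_iSup₂ (f := fun (u : Fin n → ℂ) (_ : u ≠ 0) => ‖fderiv ℂ (D.extend g) z u‖ₑ
              / ENNReal.ofReal (Real.sqrt (bergmanMetric D.carrier z u u).re)) u hu)

theorem Q_smul (c : ℂ) {f : D.carrier → ℂ} (hf : D.Holo f) {z : Fin n → ℂ}
    (hz : z ∈ D.carrier) : D.Q (c • f) z = ‖c‖ₑ * D.Q f z := by
  simp only [Q, ENNReal.mul_iSup]
  refine iSup_congr fun u => iSup_congr fun _ => ?_
  rw [extend_smul, fderiv_const_smul (hf.differentiableAt hz), smul_apply,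
    enorm_smul, mul_div_assoc]

theorem beta_zero : D.beta 0 = 0 := by simp [beta, Q_zero]

theorem beta_add_le {f g : D.carrier → ℂ} (hf : D.Holo f) (hg : D.Holo g) :
    D.beta (f + g) ≤ D.beta f + D.beta g :=
  iSup₂_le fun z hz => (Q_add_le hf hg hz).trans <| add_le_add
    (le_iSup₂ (f := fun z (_ : z ∈ D.carrier) => D.Q f z) z hz)
    (le_iSup₂ (f := fun z (_ : z ∈ D.carrier) => D.Q g z) z hz)

theorem beta_smul (c : ℂ) {f : D.carrier → ℂ} (hf : D.Holo f) :
    D.beta (c • f) = ‖c‖ₑ * D.beta f := by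
  simp only [beta, ENNReal.mul_iSup]
  exact iSup_congr fun z => iSup_congr fun hz => Q_smul c hf hz

/-- A holomorphic function with `β_f = 0` is constant. -/
theorem eq_of_beta_eq_zero {f : D.carrier → ℂ} (hf : D.Holo f) (h : D.beta f = 0)
    (z w : D.carrier) : f z = f w := by
  rw [← D.extend_apply f z, ← D.extend_apply f w]
  refine D.isOpen.is_const_of_fderiv_eq_zero (𝕜 := ℂ) D.isConnected.isPreconnected hf
    (fun x hx => ?_) z.2 w.2
  ext1 u
  rcases eq_or_ne u 0 with rfl | hu
  · simp
  · simp only [beta, Q, ENNReal.iSup_eq_zero] at h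
    have := h x hx u hu
    rw [ENNReal.div_eq_zero_iff] at this
    simpa using this

/-! ### The Bloch space and the `*`-little Bloch space -/

variable (D)

/-- The vector space of Bloch functions on `D`. -/
def blochSubmodule : Submodule ℂ (D.carrier → ℂ) where
  carrier := {f | D.Holo f ∧ D.beta f < ∞}
  zero_mem' := ⟨D.holo_zero, by simp [beta_zero]⟩
  add_mem' hf hg := ⟨hf.1.add hg.1,
    (beta_add_le hf.1 hg.1).trans_lt (ENNReal.add_lt_top.2 ⟨hf.2, hg.2⟩)⟩
  smul_mem' c f hf := ⟨hf.1.smul c, by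
    rw [beta_smul c hf.1]; exact ENNReal.mul_lt_top enorm_lt_top hf.2⟩

/-- The Bloch space `𝓑(D)` with base point `z₀`, normed by `‖f‖ = |f(z₀)| + β_f`. -/
def BlochSpace (_z₀ : D.carrier) : Type := D.blochSubmodule

variable {D}

namespace BlochSpace

variable {z₀ : D.carrier}

noncomputable instance : AddCommGroup (D.BlochSpace z₀) :=
  inferInstanceAs (AddCommGroup D.blochSubmodule)

noncomputable instance : Module ℂ (D.BlochSpace z₀) :=
  inferInstanceAs (Module ℂ D.blochSubmodule)

/-- The underlying function of an element of the Bloch space. -/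
def toFun (f : D.BlochSpace z₀) : D.carrier → ℂ := Subtype.val (p := (· ∈ D.blochSubmodule)) f

theorem holo (f : D.BlochSpace z₀) : D.Holo f.toFun := f.2.1

theorem beta_lt_top (f : D.BlochSpace z₀) : D.beta f.toFun < ∞ := f.2.2

theorem toFun_zero : (0 : D.BlochSpace z₀).toFun = 0 := rfl

theorem toFun_add (f g : D.BlochSpace z₀) : (f + g).toFun = f.toFun + g.toFun := rfl

theorem toFun_smul (c : ℂ) (f : D.BlochSpace z₀) : (c • f).toFun = c • f.toFun := rfl

noncomputable instance : Norm (D.BlochSpace z₀) :=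
  ⟨fun f => ‖f.toFun z₀‖ + (D.beta f.toFun).toReal⟩

theorem norm_def (f : D.BlochSpace z₀) : ‖f‖ = ‖f.toFun z₀‖ + (D.beta f.toFun).toReal := rfl

theorem core : NormedSpace.Core ℂ (D.BlochSpace z₀) where
  norm_nonneg f := by rw [norm_def]; positivity
  norm_smul c f := by
    rw [norm_def, norm_def, toFun_smul, beta_smul c f.holo, ENNReal.toReal_mul]
    simp [mul_add]
  norm_triangle f g := by
    simp only [norm_def, toFun_add]
    have h1 := norm_add_le (f.toFun z₀) (g.toFun z₀)
    have h2 : (D.beta (f.toFun + g.toFun)).toReal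
        ≤ (D.beta f.toFun).toReal + (D.beta g.toFun).toReal := by
      rw [← ENNReal.toReal_add f.beta_lt_top.ne g.beta_lt_top.ne]
      exact ENNReal.toReal_mono (ENNReal.add_lt_top.2 ⟨f.beta_lt_top, g.beta_lt_top⟩).ne
        (beta_add_le f.holo g.holo)
    simp only [Pi.add_apply]
    linarith
  norm_eq_zero_iff f := by
    constructor
    · intro h
      rw [norm_def, add_eq_zero_iff_of_nonneg (norm_nonneg _) ENNReal.toReal_nonneg,
        norm_eq_zero, ENNReal.toReal_eq_zero_iff] at h
      have hb : D.beta f.toFun = 0 := h.2.resolve_right f.beta_lt_top.ne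
      exact Subtype.ext (funext fun z => (eq_of_beta_eq_zero f.holo hb z z₀).trans h.1)
    · rintro rfl
      simp [norm_def, toFun_zero, beta_zero]

noncomputable instance : NormedAddCommGroup (D.BlochSpace z₀) := NormedAddCommGroup.ofCore core

noncomputable instance : NormedSpace ℂ (D.BlochSpace z₀) := NormedSpace.ofCore core

end BlochSpace

/-- The `*`-little Bloch space `𝓑_{0*}(D)`, the subspace of all `f ∈ 𝓑(D)` such that `Q_f(z) → 0`
as `z ∈ D` tends to the distinguished boundary. -/
def starLittleBloch (D : BoundedHomogeneousDomain n) (z₀ : D.carrier) :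
    Submodule ℂ (D.BlochSpace z₀) where
  carrier := {f | Tendsto (D.Q f.toFun) (𝓝ˢ (distinguishedBoundary D.carrier) ⊓ 𝓟 D.carrier) (𝓝 0)}
  zero_mem' := by
    simp only [Set.mem_ofPred_eq, BlochSpace.toFun_zero]
    exact tendsto_const_nhds.congr fun z => (Q_zero z).symm
  add_mem' {f g} hf hg := by
    simp only [Set.mem_ofPred_eq] at hf hg ⊢
    have h := hf.add hg
    rw [add_zero] at h
    refine tendsto_of_tendsto_of_tendsto_of_le_of_le' tendsto_const_nhds h
      (Eventually.of_forall fun _ => zero_le) ?_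
    filter_upwards [mem_inf_of_right (mem_principal_self D.carrier)] with z hz
    exact Q_add_le f.holo g.holo hz
  smul_mem' c f hf := by
    simp only [Set.mem_ofPred_eq] at hf ⊢
    have h := ENNReal.Tendsto.const_mul (a := ‖c‖ₑ) hf (Or.inr enorm_ne_top)
    rw [mul_zero] at h
    refine h.congr' ?_
    filter_upwards [mem_inf_of_right (mem_principal_self D.carrier)] with z hz
    exact (Q_smul c f.holo hz).symm

/-- `M_ψ : f ↦ ψ f` is a compact operator on the subspace `X` of the Bloch space (`X = ⊤` is the whole
Bloch space); in particular it maps `X` into itself. -/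
def IsCompactMultiplication {z₀ : D.carrier} (ψ : D.carrier → ℂ)
    (X : Submodule ℂ (D.BlochSpace z₀)) : Prop :=
  ∃ T : X →L[ℂ] X,
    (∀ f : X, (T f : D.BlochSpace z₀).toFun = ψ * (f : D.BlochSpace z₀).toFun) ∧
      IsCompactOperator T

end BoundedHomogeneousDomain

/-! Compactness. Let `M_ψ` be compact on a space `X` of Bloch functions containing the constants,
and suppose `ψ z ≠ 0`. Every function in the range of `M_ψ - ψ z` vanishes at `z`, so the constant 1
is not in the range. By the Fredholm alternative `ψ z` is then an eigenvalue: `(ψ - ψ z) f = 0` with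
`f ≠ 0`. The identity theorem makes `ψ` constant, so the identity of `X` is compact and `X` is
finite-dimensional. Hence `ψ = 0` whenever `X` is infinite-dimensional. Completeness of `X` is never
established; `IsCompactOperator.surjective_sub_smul` proves the alternative without it.

Infinite dimension. The witnesses are polynomials in one coordinate. They are Bloch because the
Bergman metric dominates derivatives of bounded functions (`norm_fderiv_sq_le_bergmanMetric`).
Indeed `log K(z,z)` is the logarithm of the squared norm of the evaluation functional at `z`, so its
Levi form is the squared length of the part of the derivative of evaluation orthogonal to the kernel
vector `e`, divided by `‖e‖ ^ 2`. Testing against `(g - g z) e` gives the bound.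

Little Bloch space. Let `h` vanish only at `ζ`, let `z ∈ D` be close to `ζ`, and let the
automorphism `φ` take a fixed point of `D` to `z`. Then `h ∘ φ` is zero-free, bounded, and small at
the fixed point, so by Harnack it is small on a fixed ball. Therefore `φ` sends that ball close to
`ζ`, and `g ∘ φ` is nearly constant there for every `g` in `A(D)`. Cauchy's estimate makes its
derivative small, and the derivative of the bounded map `φ⁻¹` is controlled by the Bergman metric at
`z`. So `Q_g → 0` at `ζ` (`tendsto_Q_restrict`). -/

/-! ### Holomorphic maps between normed spaces -/

section SeveralComplexVariables

open Metric

variable {E : Type*} [NormedAddCommGroup E] [NormedSpace ℂ E]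
  {F : Type*} [NormedAddCommGroup F] [NormedSpace ℂ F]

/-- Cauchy's estimate for the derivative of a bounded holomorphic map on a ball. -/
theorem norm_fderiv_le_of_norm_le_on_ball {f : E → F} {c : E} {R M : ℝ} (hR : 0 < R)
    (hf : DifferentiableOn ℂ f (ball c R)) (hM : ∀ z ∈ ball c R, ‖f z‖ ≤ M) :
    ‖fderiv ℂ f c‖ ≤ 2 * M / R := by
  refine Complex.norm_fderiv_le_div_of_mapsTo_ball hf (fun z hz => ?_) hR
  rw [mem_closedBall, dist_eq_norm]
  linarith [norm_sub_le (f z) (f c), hM z hz, hM c (mem_ball_self hR)]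

/-- Second order Taylor estimate for a bounded holomorphic map on a ball. -/
theorem norm_sub_sub_fderiv_le_on_ball {f : E → F} {c : E} {R M : ℝ} (hR : 0 < R)
    (hf : DifferentiableOn ℂ f (ball c R)) (hM : ∀ z ∈ ball c R, ‖f z‖ ≤ M) {z : E}
    (hz : z ∈ ball c R) :
    ‖f z - f c - fderiv ℂ f c (z - c)‖ ≤ 4 * M * (‖z - c‖ / R) ^ 2 := by
  have hd : DifferentiableAt ℂ f c := (hf c (mem_ball_self hR)).differentiableAt (ball_mem_nhds c hR)
  -- Without its linear part, `f` agrees with `f c` to second order, so the higher-order Schwarz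
  -- lemma yields the square. The constant is `M + 2M + M`.
  set g : E → F := fun z => f z - fderiv ℂ f c (z - c) with hg
  have hgc : g c = f c := by simp [hg]
  have hM0 : 0 ≤ M := (norm_nonneg _).trans (hM c (mem_ball_self hR))
  have key := Complex.dist_le_mul_div_pow_of_mapsTo_ball_of_isLittleO (f := g) (c := c) (z := z)
    (R₁ := R) (R₂ := 4 * M) (n := 1) ?_ ?_ ?_ hz
  · rw [dist_eq_norm, dist_eq_norm, hgc] at key
    simp only [hg] at key
    rw [sub_right_comm]
    exact key
  · exact hf.sub ((fderiv ℂ f c).differentiable.comp (differentiable_id.sub_const c)).differentiableOn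
  · intro w hw
    rw [mem_closedBall, dist_eq_norm, hgc]
    have h1 : ‖fderiv ℂ f c (w - c)‖ ≤ 2 * M := by
      refine ((fderiv ℂ f c).le_opNorm _).trans ?_
      have := norm_fderiv_le_of_norm_le_on_ball hR hf hM
      have hw' : ‖w - c‖ ≤ R := by rw [← dist_eq_norm]; exact (mem_ball.1 hw).le
      calc _ ≤ 2 * M / R * R := by gcongr
        _ = _ := by field_simp
    have h2 := hM w hw
    have h3 := hM c (mem_ball_self hR)
    calc ‖g w - f c‖ = ‖f w - fderiv ℂ f c (w - c) - f c‖ := rfl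
      _ ≤ ‖f w‖ + ‖fderiv ℂ f c (w - c)‖ + ‖f c‖ :=
        (norm_sub_le _ _).trans (add_le_add_left (norm_sub_le _ _) _)
      _ ≤ 4 * M := by linarith
  · have := hd.hasFDerivAt.isLittleO
    simp only [pow_one, hgc]
    refine (this.congr_left fun w => ?_).trans_isBigO (Asymptotics.isBigO_norm_right.2
      (Asymptotics.isBigO_refl _ _))
    simp only [hg]; abel

/-- A uniform limit of holomorphic maps on a ball is differentiable at the centre. -/
theorem differentiableAt_of_tendstoUniformlyOn_ball [CompleteSpace F] {ι : Type*} {l : Filter ι}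
    [l.NeBot] {f : ι → E → F} {g : E → F} {c : E} {R : ℝ} (hR : 0 < R)
    (hf : ∀ᶠ i in l, DifferentiableOn ℂ (f i) (ball c R))
    (h : TendstoUniformlyOn f g l (ball c R)) : DifferentiableAt ℂ g c := by
  have hcauchy : UniformCauchySeqOn (fun i z => fderiv ℂ (f i) z) l (ball c (R / 2)) := by
    intro u hu
    obtain ⟨ε, hε, hεu⟩ := mem_uniformity_dist.1 hu
    -- Cauchy's estimate at radius `R / 2` costs a factor `4 / R`, which turns `ε R / 8` into `ε /
    -- 2`.
    have h1 := h.uniformCauchySeqOn {p | dist p.1 p.2 < ε * R / 8}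
      (dist_mem_uniformity (by positivity))
    filter_upwards [h1, hf.prod_mk hf] with m hm hd z hz
    apply hεu
    have hsub : ball z (R / 2) ⊆ ball c R := by
      apply ball_subset_ball'
      have := mem_ball.1 hz
      linarith
    have hzR : z ∈ ball c R := hsub (mem_ball_self (by positivity))
    have e1 := (hd.1 z hzR).differentiableAt (isOpen_ball.mem_nhds hzR)
    have e2 := (hd.2 z hzR).differentiableAt (isOpen_ball.mem_nhds hzR)
    rw [dist_eq_norm, ← fderiv_sub e1 e2]
    refine (norm_fderiv_le_of_norm_le_on_ball (R := R / 2) (M := ε * R / 8) (by positivity)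
      ((hd.1.mono hsub).sub (hd.2.mono hsub)) fun w hw => ?_).trans_lt ?_
    · have := hm w (hsub hw)
      rw [dist_eq_norm] at this
      exact this.le
    · field_simp
      norm_num
  have hex : ∀ z ∈ ball c (R / 2), ∃ L, Tendsto (fun i => fderiv ℂ (f i) z) l (𝓝 L) :=
    fun z hz => CompleteSpace.complete (hcauchy.cauchy_map hz)
  choose! g' hg' using hex
  have hc : ball c (R / 2) ∈ 𝓝 c := ball_mem_nhds c (by positivity)
  refine (hasFDerivAt_of_tendstoUniformlyOnFilter (f := f) (l := l) (g' := g')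
    (f' := fun i z => fderiv ℂ (f i) z) ?_ ?_ ?_).differentiableAt
  · exact (hcauchy.tendstoUniformlyOn_of_tendsto hg').tendstoUniformlyOnFilter.mono_right
      (le_principal_iff.2 hc)
  · have := hf.prod_mk (eventually_mem_set.2 (ball_mem_nhds c hR))
    filter_upwards [this] with p hp
    exact ((hp.1 _ hp.2).differentiableAt (isOpen_ball.mem_nhds hp.2)).hasFDerivAt
  · filter_upwards [ball_mem_nhds c hR] with z hz
    exact h.tendsto_at hz

/-- Directional derivatives of a holomorphic map are holomorphic. -/
theorem DifferentiableOn.fderiv_apply_of_complex [CompleteSpace F] {f : E → F} {U : Set E}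
    (hf : DifferentiableOn ℂ f U) (hU : IsOpen U) (v : E) :
    DifferentiableOn ℂ (fun z => fderiv ℂ f z v) U := by
  intro c hc
  apply DifferentiableAt.differentiableWithinAt
  obtain ⟨M, hM⟩ : ∃ M, ∀ᶠ z in 𝓝 c, ‖f z‖ ≤ M := by
    have := (hf.continuousOn.continuousAt (hU.mem_nhds hc)).norm
    exact ⟨‖f c‖ + 1, (this.eventually_lt_const (lt_add_one _)).mono fun _ h => h.le⟩
  obtain ⟨R, hR, hRU⟩ := Metric.eventually_nhds_iff_ball.1 (hM.and (hU.mem_nhds hc))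
  have hM0 : 0 ≤ M := (norm_nonneg _).trans (hRU c (mem_ball_self hR)).1
  -- The directional derivative is the uniform limit of holomorphic difference quotients; the
  -- second-order Taylor estimate bounds the error by a multiple of `‖t‖`.
  refine differentiableAt_of_tendstoUniformlyOn_ball (l := 𝓝[≠] (0 : ℂ)) (R := R / 2)
    (f := fun (t : ℂ) z => t⁻¹ • (f (z + t • v) - f z)) (by positivity) ?_ ?_
  · have : ∀ᶠ t in 𝓝[≠] (0 : ℂ), ‖t • v‖ < R / 2 := by
      apply eventually_nhdsWithin_of_eventually_nhds
      have : ContinuousAt (fun t : ℂ => ‖t • v‖) 0 := by fun_prop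
      exact this.eventually_lt_const (by simpa using by positivity)
    filter_upwards [this] with t ht
    refine (DifferentiableOn.sub ?_ (hf.mono fun z hz => ?_)).const_smul t⁻¹
    · refine hf.comp (differentiable_id.add_const _).differentiableOn fun z hz => (hRU _ ?_).2
      rw [mem_ball, dist_eq_norm] at hz ⊢
      calc ‖z + t • v - c‖ = ‖(z - c) + t • v‖ := by congr 1; abel
        _ ≤ _ := norm_add_le _ _
        _ < R := by linarith
    · exact (hRU z (ball_subset_ball (by linarith) hz)).2
  · rw [Metric.tendstoUniformlyOn_iff]
    intro ε hε
    have h1 : ∀ᶠ t in 𝓝[≠] (0 : ℂ), ‖t • v‖ < R / 2 := by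
      apply eventually_nhdsWithin_of_eventually_nhds
      have : ContinuousAt (fun t : ℂ => ‖t • v‖) 0 := by fun_prop
      exact this.eventually_lt_const (by simpa using by positivity)
    have h2 : ∀ᶠ t in 𝓝[≠] (0 : ℂ), 4 * M * (‖v‖ / (R / 2)) ^ 2 * ‖t‖ < ε := by
      apply eventually_nhdsWithin_of_eventually_nhds
      have : ContinuousAt (fun t : ℂ => 4 * M * (‖v‖ / (R / 2)) ^ 2 * ‖t‖) 0 := by fun_prop
      exact this.eventually_lt_const (by simpa using hε)
    filter_upwards [h1, h2, self_mem_nhdsWithin] with t ht1 ht2 ht0 z hz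
    have ht0 : t ≠ 0 := ht0
    have hsub : ∀ w ∈ ball z (R / 2), w ∈ ball c R := by
      apply ball_subset_ball'
      have := mem_ball.1 hz
      linarith
    have hzt : z + t • v ∈ ball z (R / 2) := by simpa [mem_ball, dist_eq_norm] using ht1
    have := norm_sub_sub_fderiv_le_on_ball (f := f) (c := z) (R := R / 2) (M := M) (by positivity)
      (hf.mono fun w hw => (hRU w (hsub w hw)).2) (fun w hw => (hRU w (hsub w hw)).1) hzt
    rw [dist_comm, dist_eq_norm]
    refine lt_of_le_of_lt ?_ ht2
    have e : t⁻¹ • (f (z + t • v) - f z) - fderiv ℂ f z v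
        = t⁻¹ • (f (z + t • v) - f z - fderiv ℂ f z (z + t • v - z)) := by
      rw [add_sub_cancel_left, map_smul, smul_sub t⁻¹ (_ - _), inv_smul_smul₀ ht0]
    rw [e, norm_smul, norm_inv]
    have htp : 0 < ‖t‖ := norm_pos_iff.2 ht0
    rw [inv_mul_le_iff₀ htp]
    refine this.trans (le_of_eq ?_)
    rw [add_sub_cancel_left, norm_smul]
    field_simp

/-- The identity theorem for holomorphic maps on a connected open set. -/
theorem eqOn_zero_of_eventuallyEq_zero_of_complex [CompleteSpace F] {f : E → F} {U : Set E}
    (hf : DifferentiableOn ℂ f U) (hU : IsOpen U) (hc : IsPreconnected U) {p : E} (hp : p ∈ U)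
    (h0 : f =ᶠ[𝓝 p] 0) : ∀ z ∈ U, f z = 0 := by
  let V : Set E := {z | f =ᶠ[𝓝 z] 0}
  have hV : IsOpen V := isOpen_setOfPred_eventually_nhds
  suffices U ⊆ V from fun z hz => (this hz).self_of_nhds
  refine hc.subset_of_closure_inter_subset hV ⟨p, hp, h0⟩ ?_
  rintro w ⟨hwV, hwU⟩
  obtain ⟨r, hr, hrU⟩ := Metric.isOpen_iff.1 hU w hwU
  obtain ⟨a, haV, hwa⟩ := Metric.mem_closure_iff.1 hwV r hr
  have ha : a ∈ ball w r := by rwa [mem_ball, dist_comm]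
  refine Filter.eventually_of_mem (ball_mem_nhds w hr) fun b hb => ?_
  -- On the slice of the ball by the complex line through `a` and `b`, the one-variable identity
  -- theorem carries the vanishing near `t = 0` to `t = 1`.
  set ℓ : ℂ → E := fun t => a + t • (b - a) with hℓ
  have hℓd : Differentiable ℂ ℓ := (differentiable_id.smul_const _).const_add _
  set S : Set ℂ := ℓ ⁻¹' ball w r
  have hSo : IsOpen S := isOpen_ball.preimage hℓd.continuous
  have hSc : Convex ℝ S := by
    intro x hx y hy s t hs ht hst
    have : ℓ (s • x + t • y) = s • ℓ x + t • ℓ y := by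
      have h1 : a = s • a + t • a := by rw [← add_smul, hst, one_smul]
      simp only [hℓ, smul_add, add_smul, smul_assoc]
      nth_rewrite 1 [h1]
      abel
    rw [Set.mem_preimage, this]
    exact (convex_ball (E := E) w r) hx hy hs ht hst
  have hg : DifferentiableOn ℂ (f ∘ ℓ) S :=
    (hf.mono hrU).comp hℓd.differentiableOn fun t ht => ht
  have h0S : (0 : ℂ) ∈ S := by simpa [S, hℓ] using ha
  have h1S : (1 : ℂ) ∈ S := by simpa [S, hℓ] using hb
  have hev : (f ∘ ℓ) =ᶠ[𝓝 0] 0 := by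
    have : Tendsto ℓ (𝓝 0) (𝓝 a) := by simpa [hℓ] using hℓd.continuous.tendsto 0
    exact this.eventually haV
  have := (hg.analyticOnNhd hSo).eqOn_zero_of_preconnected_of_eventuallyEq_zero
    hSc.isPreconnected h0S hev h1S
  simpa [hℓ] using this

end SeveralComplexVariables

/-! ### Sub-mean value property -/

section MeanValue

open Metric

theorem measurePreserving_smul_pi_complex {n : ℕ} {a : ℂ} (ha : ‖a‖ = 1) :
    MeasurePreserving (fun w : Fin n → ℂ => a • w) volume volume := by
  have h1 : MeasurePreserving (fun z : ℂ => a * z) volume volume := by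
    have := (rotation ⟨a, by simpa [Submonoid.unitSphere] using ha⟩).measurePreserving
    simpa using! this
  exact volume_preserving_pi (fun _ : Fin n => h1)

/-- The sub-mean value property of the modulus of a holomorphic function on a polydisc. -/
theorem volume_ball_mul_enorm_le_lintegral {n : ℕ} {f : (Fin n → ℂ) → ℂ} {c : Fin n → ℂ} {r : ℝ}
    (hf : DifferentiableOn ℂ f (ball c r)) :
    volume (ball c r) * ‖f c‖ₑ ≤ ∫⁻ z in ball c r, ‖f z‖ₑ := by
  classical
  have hFm : Measurable ((ball c r).indicator f) := by
    have := hf.continuousOn.measurable_piecewise (g := fun _ => (0 : ℂ)) continuousOn_const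
      (measurableSet_ball (x := c) (ε := r))
    simpa [Set.piecewise_eq_indicator] using! this
  set G : (Fin n → ℂ) → ℝ≥0∞ := fun w => ‖(ball c r).indicator f (c + w)‖ₑ with hG
  have hGm : Measurable G := by fun_prop
  have hGint : ∫⁻ w, G w = ∫⁻ z in ball c r, ‖f z‖ₑ := by
    rw [hG, lintegral_add_left_eq_self (fun w => ‖(ball c r).indicator f w‖ₑ) c,
      ← lintegral_indicator measurableSet_ball]
    simp [enorm_indicator_eq_indicator_enorm]
  -- Mean value property on the disc `t ↦ c + t • w`. Integrating over `w` and swapping the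
  -- integrals leaves only `∫ G`, since rotations preserve volume.
  have hpt : ∀ w ∈ ball (0 : Fin n → ℂ) r,
      ENNReal.ofReal (2 * Real.pi) * ‖f c‖ₑ
        ≤ ∫⁻ θ in Set.Ioc 0 (2 * Real.pi), G (circleMap 0 1 θ • w) := by
    intro w hw
    have hw : ‖w‖ < r := by simpa using hw
    have hmaps : ∀ t ∈ closedBall (0 : ℂ) 1, c + t • w ∈ ball c r := by
      intro t ht
      have ht : ‖t‖ ≤ 1 := by simpa using ht
      rw [mem_ball, dist_eq_norm, add_sub_cancel_left, norm_smul]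
      nlinarith [norm_nonneg w]
    have hd : DiffContOnCl ℂ (fun t : ℂ => f (c + t • w)) (ball 0 |1|) := by
      rw [abs_one]
      apply DifferentiableOn.diffContOnCl_ball (U := (fun t : ℂ => c + t • w) ⁻¹' ball c r) _ hmaps
      exact hf.comp ((differentiable_id.smul_const _).const_add _).differentiableOn fun t ht => ht
    have h1 := hd.circleAverage
    rw [Real.circleAverage_def, zero_smul, add_zero,
      intervalIntegral.integral_of_le Real.two_pi_pos.le] at h1
    have h2 : ∫ θ in Set.Ioc 0 (2 * Real.pi), f (c + circleMap 0 1 θ • w)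
        = (2 * Real.pi) • f c := by
      rw [← h1, smul_inv_smul₀ Real.two_pi_pos.ne']
    calc ENNReal.ofReal (2 * Real.pi) * ‖f c‖ₑ = ‖(2 * Real.pi) • f c‖ₑ := by
          rw [enorm_smul, Real.enorm_of_nonneg Real.two_pi_pos.le]
      _ ≤ ∫⁻ θ in Set.Ioc 0 (2 * Real.pi), ‖f (c + circleMap 0 1 θ • w)‖ₑ := by
          rw [← h2]; exact enorm_integral_le_lintegral_enorm _
      _ = _ := by
          refine lintegral_congr fun θ => ?_
          rw [hG]
          simp only
          rw [Set.indicator_of_mem (hmaps _ (by simp))]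
  have hvol : volume (ball (0 : Fin n → ℂ) r) = volume (ball c r) := by
    rw [← Measure.addHaar_ball_center volume c r]
  have key : ENNReal.ofReal (2 * Real.pi) * (volume (ball c r) * ‖f c‖ₑ)
      ≤ ENNReal.ofReal (2 * Real.pi) * ∫⁻ w, G w := by
    calc ENNReal.ofReal (2 * Real.pi) * (volume (ball c r) * ‖f c‖ₑ)
        = ∫⁻ _ in ball (0 : Fin n → ℂ) r, ENNReal.ofReal (2 * Real.pi) * ‖f c‖ₑ := by
          rw [setLIntegral_const, hvol]; ring
      _ ≤ ∫⁻ w in ball (0 : Fin n → ℂ) r,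
            ∫⁻ θ in Set.Ioc 0 (2 * Real.pi), G (circleMap 0 1 θ • w) :=
          setLIntegral_mono' measurableSet_ball hpt
      _ ≤ ∫⁻ w, ∫⁻ θ in Set.Ioc 0 (2 * Real.pi), G (circleMap 0 1 θ • w) :=
          setLIntegral_le_lintegral _ _
      _ = ∫⁻ θ in Set.Ioc 0 (2 * Real.pi), ∫⁻ w, G (circleMap 0 1 θ • w) := by
          refine lintegral_lintegral_swap (Measurable.aemeasurable ?_)
          have : Measurable fun p : (Fin n → ℂ) × ℝ => circleMap 0 1 p.2 • p.1 := by
            have : Continuous fun p : (Fin n → ℂ) × ℝ => circleMap 0 1 p.2 • p.1 := by fun_prop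
            exact this.measurable
          exact hGm.comp this
      _ = ∫⁻ _ in Set.Ioc 0 (2 * Real.pi), ∫⁻ w, G w := by
          refine lintegral_congr fun θ => ?_
          exact (measurePreserving_smul_pi_complex (by simp)).lintegral_comp hGm
      _ = _ := by simp [mul_comm]
  rw [hGint] at key
  refine (ENNReal.mul_le_mul_iff_right ?_ ENNReal.ofReal_ne_top).1 key
  simp [Real.pi_pos]

end MeanValue

/-! ### Holomorphic dependence of point evaluations -/

section Evaluation

open Metric

/-- A normed space of holomorphic functions with locally uniformly bounded evaluations has a
holomorphic evaluation map into the strong dual. -/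
theorem exists_differentiableOn_evaluation {E : Type*} [NormedAddCommGroup E] [NormedSpace ℂ E]
    {H : Type*} [NormedAddCommGroup H] [NormedSpace ℂ H] {D : Set E} (hD : IsOpen D)
    (Φ : H → E → ℂ) (hadd : ∀ f g, ∀ z ∈ D, Φ (f + g) z = Φ f z + Φ g z)
    (hsmul : ∀ (c : ℂ) f, ∀ z ∈ D, Φ (c • f) z = c * Φ f z)
    (hΦ : ∀ f, DifferentiableOn ℂ (Φ f) D)
    (hb : ∀ w ∈ D, ∃ R > 0, ∃ C, ball w R ⊆ D ∧ ∀ f, ∀ z ∈ ball w R, ‖Φ f z‖ ≤ C * ‖f‖) :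
    ∃ δ : E → StrongDual ℂ H, DifferentiableOn ℂ δ D ∧ ∀ z ∈ D, ∀ f, δ z f = Φ f z := by
  classical
  have hδ : ∀ z ∈ D, ∃ L : StrongDual ℂ H, ∀ f, L f = Φ f z := by
    intro z hz
    obtain ⟨R, hR, C, -, hC⟩ := hb z hz
    exact ⟨LinearMap.mkContinuous ⟨⟨fun f => Φ f z, fun f g => hadd f g z hz⟩,
      fun c f => hsmul c f z hz⟩ C fun f => hC f z (mem_ball_self hR), fun f => rfl⟩
  choose! δ hδ using hδ
  refine ⟨δ, fun w hw => DifferentiableAt.differentiableWithinAt ?_, hδ⟩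
  obtain ⟨R, hR, C, hRD, hC⟩ := hb w hw
  have hdiff : ∀ f, DifferentiableAt ℂ (Φ f) w := fun f =>
    (hΦ f w hw).differentiableAt (hD.mem_nhds hw)
  -- The candidate derivative of the evaluation map is `f ↦ fderiv ℂ (Φ f) w` with its two arguments
  -- exchanged; Cauchy's estimate makes it bounded.
  let T : H →L[ℂ] (E →L[ℂ] ℂ) := LinearMap.mkContinuous
    ⟨⟨fun f => fderiv ℂ (Φ f) w, fun f g => by
      rw [← fderiv_add (hdiff f) (hdiff g)]
      have : Φ (f + g) =ᶠ[𝓝 w] Φ f + Φ g := eventually_of_mem (hD.mem_nhds hw) (hadd f g)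
      exact this.fderiv_eq⟩,
      fun c f => by
      rw [RingHom.id_apply, ← fderiv_const_smul (hdiff f)]
      have : Φ (c • f) =ᶠ[𝓝 w] c • Φ f := eventually_of_mem (hD.mem_nhds hw) (hsmul c f)
      exact this.fderiv_eq⟩ (2 * C / R) fun f => by
      refine (norm_fderiv_le_of_norm_le_on_ball hR ((hΦ f).mono hRD) (hC f)).trans (le_of_eq ?_)
      ring
  have hT : ∀ f v, T.flip v f = fderiv ℂ (Φ f) w v := fun f v => rfl
  refine HasFDerivAt.differentiableAt (f' := T.flip) ?_
  rw [hasFDerivAt_iff_isLittleO_nhds_zero]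
  -- The Taylor remainder is bounded uniformly over the unit ball of `H`, hence in the norm of the
  -- dual.
  have hO : (fun v => δ (w + v) - δ w - T.flip v) =O[𝓝 0] fun v : E => ‖v‖ ^ 2 := by
    refine Asymptotics.IsBigO.of_bound (4 * |C| / R ^ 2) ?_
    filter_upwards [ball_mem_nhds (0 : E) hR] with v hv
    have hwv : w + v ∈ ball w R := by simpa [mem_ball, dist_eq_norm] using hv
    refine ContinuousLinearMap.opNorm_le_bound _ (by positivity) fun f => ?_
    have := norm_sub_sub_fderiv_le_on_ball (M := |C| * ‖f‖) hR ((hΦ f).mono hRD)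
      (fun z hz => (hC f z hz).trans (by gcongr; exact le_abs_self C)) hwv
    rw [add_sub_cancel_left] at this
    rw [sub_apply, sub_apply, hT, hδ _ (hRD hwv),
      hδ w hw]
    refine this.trans (le_of_eq ?_)
    rw [norm_pow, norm_norm]
    ring
  refine hO.trans_isLittleO ?_
  have : (fun v : E => ‖v‖ ^ 2) =o[𝓝 0] fun v : E => ‖v‖ :=
    (Asymptotics.isLittleO_pow_id (𝕜 := ℝ) one_lt_two).comp_tendsto
      (tendsto_norm_zero (E := E))
  exact this.norm_right.trans_isBigO (Asymptotics.isBigO_norm_left.2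
    (Asymptotics.isBigO_norm_left.2 (Asymptotics.isBigO_refl _ _)))

end Evaluation

/-! ### The Bergman space and its kernel -/

section BergmanSpace

open Metric

variable {n : ℕ}

/-- The Bergman space of `D` as a subspace of `L²(D)`. -/
def bergmanSpace (D : Set (Fin n → ℂ)) : Submodule ℂ (Lp ℂ 2 (volume.restrict D)) where
  carrier := {f | ∃ g, DifferentiableOn ℂ g D ∧ f =ᵐ[volume.restrict D] g}
  zero_mem' := ⟨0, differentiableOn_const 0, Lp.coeFn_zero _ _ _⟩
  add_mem' := by
    rintro f f' ⟨g, hg, hfg⟩ ⟨g', hg', hfg'⟩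
    exact ⟨g + g', hg.add hg', (Lp.coeFn_add f f').trans (hfg.add hfg')⟩
  smul_mem' := by
    rintro c f ⟨g, hg, hfg⟩
    exact ⟨c • g, hg.const_smul c, (Lp.coeFn_smul c f).trans (hfg.const_smul c)⟩

namespace bergmanSpace

variable {D : Set (Fin n → ℂ)}

/-- The holomorphic representative of an element of the Bergman space. -/
noncomputable def rep (f : bergmanSpace D) : (Fin n → ℂ) → ℂ := f.2.choose

theorem differentiableOn_rep (f : bergmanSpace D) : DifferentiableOn ℂ (rep f) D :=
  f.2.choose_spec.1

theorem coeFn_ae_eq_rep (f : bergmanSpace D) : f.1 =ᵐ[volume.restrict D] rep f :=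
  f.2.choose_spec.2

theorem rep_eqOn (hD : IsOpen D) (f : bergmanSpace D) {g : (Fin n → ℂ) → ℂ}
    (hg : DifferentiableOn ℂ g D) (h : f.1 =ᵐ[volume.restrict D] g) : Set.EqOn (rep f) g D :=
  Measure.eqOn_open_of_ae_eq ((coeFn_ae_eq_rep f).symm.trans h) hD
    (differentiableOn_rep f).continuousOn hg.continuousOn

theorem rep_add (hD : IsOpen D) (f g : bergmanSpace D) {z : Fin n → ℂ} (hz : z ∈ D) :
    rep (f + g) z = rep f z + rep g z :=
  rep_eqOn hD (f + g) ((differentiableOn_rep f).add (differentiableOn_rep g))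
    ((Lp.coeFn_add f.1 g.1).trans ((coeFn_ae_eq_rep f).add (coeFn_ae_eq_rep g))) hz

theorem rep_smul (hD : IsOpen D) (c : ℂ) (f : bergmanSpace D) {z : Fin n → ℂ} (hz : z ∈ D) :
    rep (c • f) z = c * rep f z :=
  rep_eqOn hD (c • f) ((differentiableOn_rep f).const_smul c)
    ((Lp.coeFn_smul c f.1).trans ((coeFn_ae_eq_rep f).const_smul c)) hz

theorem memBergmanSpace_rep (f : bergmanSpace D) : MemBergmanSpace D (rep f) :=
  ⟨differentiableOn_rep f, (Lp.memLp f.1).ae_eq (coeFn_ae_eq_rep f)⟩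

/-- The element of the Bergman space given by a square integrable holomorphic function. -/
noncomputable def ofMem {f : (Fin n → ℂ) → ℂ} (hf : MemBergmanSpace D f) : bergmanSpace D :=
  ⟨hf.2.toLp f, f, hf.1, hf.2.coeFn_toLp⟩

theorem rep_ofMem (hD : IsOpen D) {f : (Fin n → ℂ) → ℂ} (hf : MemBergmanSpace D f) :
    Set.EqOn (rep (ofMem hf)) f D := rep_eqOn hD _ hf.1 hf.2.coeFn_toLp

theorem inner_eq_integral (f g : bergmanSpace D) :
    inner ℂ f g = ∫ z in D, rep g z * conj (rep f z) := by
  rw [Submodule.coe_inner, L2.inner_def]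
  refine integral_congr_ae ?_
  filter_upwards [coeFn_ae_eq_rep f, coeFn_ae_eq_rep g] with z hf hg
  rw [hf, hg]
  simp

/-- This is the sub-mean value property of the holomorphic function `f ^ 2`. -/
theorem norm_rep_le (f : bergmanSpace D) {w : Fin n → ℂ} {r : ℝ} (hr : 0 < r)
    (hw : ball w r ⊆ D) : ‖rep f w‖ ≤ (volume.real (ball w r))⁻¹ ^ (1 / 2 : ℝ) * ‖f‖ := by
  have hV : volume (ball w r) ≠ ∞ := measure_ball_lt_top.ne
  have hV0 : 0 < volume.real (ball w r) :=
    ENNReal.toReal_pos (measure_ball_pos _ _ hr).ne' hV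
  have h1 := volume_ball_mul_enorm_le_lintegral (f := fun z => rep f z ^ 2) (c := w) (r := r)
    (((differentiableOn_rep f).mono hw).pow 2)
  have h2 : ∫⁻ z in ball w r, ‖rep f z ^ 2‖ₑ ≤ ‖f‖ₑ ^ 2 := by
    have e : ‖f‖ₑ = eLpNorm (rep f) 2 (volume.restrict D) := by
      rw [← eLpNorm_congr_ae (coeFn_ae_eq_rep f), ← Lp.enorm_def]; rfl
    rw [e, eLpNorm_eq_lintegral_rpow_enorm_toReal two_ne_zero ENNReal.ofNat_ne_top,
      ← ENNReal.rpow_natCast, ← ENNReal.rpow_mul]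
    simp only [ENNReal.toReal_ofNat, Nat.cast_ofNat, ne_eq, OfNat.ofNat_ne_zero, not_false_eq_true,
      div_mul_cancel₀, ENNReal.rpow_one]
    refine (lintegral_mono_set hw).trans (le_of_eq (lintegral_congr fun z => ?_))
    rw [enorm_pow, ← ENNReal.rpow_natCast, Nat.cast_ofNat]
  have h3 : volume.real (ball w r) * ‖rep f w‖ ^ 2 ≤ ‖f‖ ^ 2 := by
    have := ENNReal.toReal_mono (by simp) (h1.trans h2)
    simpa [ENNReal.toReal_mul, Measure.real] using this
  rw [← Real.sqrt_eq_rpow, ← Real.sqrt_sq (norm_nonneg f), ← Real.sqrt_mul (by positivity)]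
  refine Real.le_sqrt_of_sq_le ?_
  rw [inv_mul_eq_div, le_div_iff₀ hV0, mul_comm]
  exact h3

theorem exists_norm_rep_le (hD : IsOpen D) {w : Fin n → ℂ} (hw : w ∈ D) :
    ∃ R > 0, ∃ C, ball w R ⊆ D ∧ ∀ f : bergmanSpace D, ∀ z ∈ ball w R, ‖rep f z‖ ≤ C * ‖f‖ := by
  obtain ⟨r, hr, hrD⟩ := Metric.isOpen_iff.1 hD w hw
  refine ⟨r / 2, by positivity, (volume.real (ball w (r / 2)))⁻¹ ^ (1 / 2 : ℝ),
    (ball_subset_ball (by linarith)).trans hrD, fun f z hz => ?_⟩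
  have := norm_rep_le f (w := z) (r := r / 2) (by positivity) ((ball_subset_ball' (by
    have := mem_ball.1 hz; linarith)).trans hrD)
  rwa [Measure.real, Measure.addHaar_ball_center volume z,
    ← Measure.addHaar_ball_center volume w, ← Measure.real] at this

theorem exists_evaluation (hD : IsOpen D) : ∃ δ : (Fin n → ℂ) → StrongDual ℂ (bergmanSpace D),
    DifferentiableOn ℂ δ D ∧ ∀ z ∈ D, ∀ f, δ z f = rep f z :=
  exists_differentiableOn_evaluation hD rep (fun f g _ hz => rep_add hD f g hz)
    (fun c f _ hz => rep_smul hD c f hz) differentiableOn_rep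
    fun _ hw => exists_norm_rep_le hD hw

/-- By the evaluation bounds, an `L²` limit is also a locally uniform limit of representatives,
hence holomorphic. An almost everywhere convergent subsequence identifies the two limits. -/
theorem isClosed (hD : IsOpen D) :
    IsClosed (bergmanSpace D : Set (Lp ℂ 2 (volume.restrict D))) := by
  refine isClosed_of_closure_subset fun f hf => ?_
  obtain ⟨u, hu, hlim⟩ := mem_closure_iff_seq_limit.1 hf
  let v : ℕ → bergmanSpace D := fun i => ⟨u i, hu i⟩
  have hv : CauchySeq v := by
    have := hlim.cauchySeq
    rw [Metric.cauchySeq_iff] at this ⊢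
    exact this
  have hunif : ∀ w ∈ D, ∃ R > 0, ball w R ⊆ D ∧
      UniformCauchySeqOn (fun i => rep (v i)) atTop (ball w R) := by
    intro w hw
    obtain ⟨R, hR, C, hRD, hC⟩ := exists_norm_rep_le hD hw
    refine ⟨R, hR, hRD, Metric.uniformCauchySeqOn_iff.2 fun ε hε => ?_⟩
    obtain ⟨N, hN⟩ := Metric.cauchySeq_iff.1 hv (ε / (|C| + 1)) (by positivity)
    refine ⟨N, fun i hi j hj z hz => ?_⟩
    have h1 := hC (v i - v j) z hz
    have h2 : rep (v i - v j) z = rep (v i) z - rep (v j) z := by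
      rw [sub_eq_add_neg, rep_add hD _ _ (hRD hz), ← neg_one_smul ℂ, rep_smul hD _ _ (hRD hz)]
      ring
    have h3 := hN i hi j hj
    rw [dist_eq_norm, lt_div_iff₀ (by positivity)] at h3
    rw [dist_eq_norm, ← h2]
    nlinarith [le_abs_self C, norm_nonneg (v i - v j)]
  have hex : ∀ z ∈ D, ∃ L, Tendsto (fun i => rep (v i) z) atTop (𝓝 L) := by
    intro z hz
    obtain ⟨R, hR, -, h⟩ := hunif z hz
    exact CompleteSpace.complete (h.cauchy_map (mem_ball_self hR))
  choose! g hg using hex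
  refine ⟨g, fun w hw => DifferentiableAt.differentiableWithinAt ?_, ?_⟩
  · obtain ⟨R, hR, hRD, h⟩ := hunif w hw
    exact differentiableAt_of_tendstoUniformlyOn_ball hR
      (Eventually.of_forall fun i => (differentiableOn_rep (v i)).mono hRD)
      (h.tendstoUniformlyOn_of_tendsto fun z hz => hg z (hRD hz))
  · obtain ⟨s, hs, hae⟩ := (tendstoInMeasure_of_tendsto_Lp hlim).exists_seq_tendsto_ae
    have hrep : ∀ᵐ z ∂volume.restrict D, ∀ i, u i z = rep (v i) z :=
      ae_all_iff.2 fun i => coeFn_ae_eq_rep (v i)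
    filter_upwards [hae, hrep, ae_restrict_mem hD.measurableSet] with z h1 h2 hz
    refine tendsto_nhds_unique h1 ?_
    simp only [h2]
    exact (hg z hz).comp hs.tendsto_atTop

theorem completeSpace (hD : IsOpen D) : CompleteSpace (bergmanSpace D) :=
  (isClosed hD).completeSpace_coe

end bergmanSpace

/-- The Bergman kernel of an open set exists. -/
theorem exists_isBergmanKernel {D : Set (Fin n → ℂ)} (hD : IsOpen D) :
    ∃ K, IsBergmanKernel D K := by
  have := bergmanSpace.completeSpace hD
  obtain ⟨δ, -, hδ⟩ := bergmanSpace.exists_evaluation hD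
  refine ⟨fun z w => bergmanSpace.rep ((InnerProductSpace.toDual ℂ _).symm (δ w)) z,
    fun w hw => ⟨bergmanSpace.memBergmanSpace_rep _, fun f hf => ?_⟩⟩
  rw [← bergmanSpace.rep_ofMem hD hf hw, ← hδ w hw, ← InnerProductSpace.toDual_symm_apply,
    bergmanSpace.inner_eq_integral]
  refine setIntegral_congr_fun hD.measurableSet fun z hz => ?_
  simp only [bergmanSpace.rep_ofMem hD hf hz]

theorem isBergmanKernel_bergmanKernel {D : Set (Fin n → ℂ)} (hD : IsOpen D) :
    IsBergmanKernel D (bergmanKernel D) := by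
  have h := exists_isBergmanKernel hD
  rw [bergmanKernel, dif_pos h]
  exact h.choose_spec

/-- The kernel is defined by choice; the reproducing property forces it to be the Riesz vector of
evaluation at `w`. -/
theorem bergmanKernel_eq_rep {D : Set (Fin n → ℂ)} (hD : IsOpen D)
    [CompleteSpace (bergmanSpace D)] {δ : (Fin n → ℂ) → StrongDual ℂ (bergmanSpace D)}
    (hδ : ∀ z ∈ D, ∀ f, δ z f = bergmanSpace.rep f z) {z w : Fin n → ℂ} (hz : z ∈ D) (hw : w ∈ D) :
    bergmanKernel D z w
      = bergmanSpace.rep ((InnerProductSpace.toDual ℂ (bergmanSpace D)).symm (δ w)) z := by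
  obtain ⟨hK, hrep⟩ := isBergmanKernel_bergmanKernel hD w hw
  have : bergmanSpace.ofMem hK = (InnerProductSpace.toDual ℂ (bergmanSpace D)).symm (δ w) := by
    refine ext_inner_right ℂ fun f => ?_
    rw [InnerProductSpace.toDual_symm_apply, hδ w hw, hrep _ (bergmanSpace.memBergmanSpace_rep f),
      bergmanSpace.inner_eq_integral]
    refine setIntegral_congr_fun hD.measurableSet fun z hz => ?_
    simp only [bergmanSpace.rep_ofMem hD hK hz]
  rw [← this, bergmanSpace.rep_ofMem hD hK hz]

end BergmanSpace

/-! ### The Levi form of the logarithm of the kernel -/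

section LeviForm

variable {n : ℕ} {z : Fin n → ℂ}

theorem wirtingerD_eq {F : (Fin n → ℂ) → ℂ} {L : (Fin n → ℂ) →L[ℝ] ℂ} (h : HasFDerivAt F L z)
    (j : Fin n) : wirtingerD j F z
      = (1 / 2) * (L (Pi.single j 1) - Complex.I * L (Complex.I • Pi.single j 1)) := by
  rw [wirtingerD, h.fderiv, ← Pi.single_smul', smul_eq_mul, mul_one]

theorem wirtingerDBar_eq {F : (Fin n → ℂ) → ℂ} {L : (Fin n → ℂ) →L[ℝ] ℂ} (h : HasFDerivAt F L z)
    (j : Fin n) : wirtingerDBar j F z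
      = (1 / 2) * (L (Pi.single j 1) + Complex.I * L (Complex.I • Pi.single j 1)) := by
  rw [wirtingerDBar, h.fderiv, ← Pi.single_smul', smul_eq_mul, mul_one]

variable {H : Type*} [NormedAddCommGroup H] [InnerProductSpace ℂ H]

theorem hasFDerivAt_inner_complex {a b : (Fin n → ℂ) → H} {A B : (Fin n → ℂ) →L[ℝ] H}
    (ha : HasFDerivAt a A z) (hb : HasFDerivAt b B z) :
    ∃ L : (Fin n → ℂ) →L[ℝ] ℂ, HasFDerivAt (fun w => inner ℂ (a w) (b w)) L z ∧
      ∀ v, L v = inner ℂ (a z) (B v) + inner ℂ (A v) (b z) :=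
  ⟨_, ha.inner ℂ hb, fun v => by simp⟩

variable [CompleteSpace H]

/-- The Riesz representation as a continuous real-linear map. -/
noncomputable def rieszCLM (H : Type*) [NormedAddCommGroup H] [InnerProductSpace ℂ H]
    [CompleteSpace H] : StrongDual ℂ H →L[ℝ] H :=
  AddMonoidHom.toRealLinearMap
    (InnerProductSpace.toDual ℂ H).symm.toLinearEquiv.toLinearMap.toAddMonoidHom
    (InnerProductSpace.toDual ℂ H).symm.continuous

theorem rieszCLM_apply (x : StrongDual ℂ H) :
    rieszCLM H x = (InnerProductSpace.toDual ℂ H).symm x := rfl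

theorem rieszCLM_smul (c : ℂ) (x : StrongDual ℂ H) :
    rieszCLM H (c • x) = conj c • rieszCLM H x := by
  simp only [rieszCLM_apply, map_smulₛₗ]

theorem inner_rieszCLM_left (x : StrongDual ℂ H) (h : H) : inner ℂ (rieszCLM H x) h = x h := by
  rw [rieszCLM_apply, InnerProductSpace.toDual_symm_apply]

theorem hasFDerivAt_rieszCLM {δ : (Fin n → ℂ) → StrongDual ℂ H} (h : DifferentiableAt ℂ δ z) :
    HasFDerivAt (fun w => rieszCLM H (δ w))
      ((rieszCLM H).comp ((fderiv ℂ δ z).restrictScalars ℝ)) z :=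
  (rieszCLM H).hasFDerivAt.comp z (h.hasFDerivAt.restrictScalars ℝ)

/-- The complex Hessian of `log ‖e‖²` for a conjugate-holomorphic map `e` into a Hilbert space. -/
theorem wirtingerD_wirtingerDBar_log_norm_sq {D : Set (Fin n → ℂ)} (hD : IsOpen D)
    {δ : (Fin n → ℂ) → StrongDual ℂ H} (hδ : DifferentiableOn ℂ δ D)
    (h0 : ∀ w ∈ D, δ w ≠ 0) {F : (Fin n → ℂ) → ℂ}
    (hF : ∀ w ∈ D, F w = (Real.log (‖rieszCLM H (δ w)‖ ^ 2) : ℂ)) (hz : z ∈ D) (j k : Fin n) :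
    wirtingerD j (wirtingerDBar k F) z
      = inner ℂ (rieszCLM H (fderiv ℂ δ z (Pi.single j 1)))
            (rieszCLM H (fderiv ℂ δ z (Pi.single k 1))) / (‖rieszCLM H (δ z)‖ : ℂ) ^ 2
        - inner ℂ (rieszCLM H (δ z)) (rieszCLM H (fderiv ℂ δ z (Pi.single k 1)))
          * inner ℂ (rieszCLM H (fderiv ℂ δ z (Pi.single j 1))) (rieszCLM H (δ z))
            / (‖rieszCLM H (δ z)‖ : ℂ) ^ 4 := by
  set e : (Fin n → ℂ) → H := fun w => rieszCLM H (δ w) with he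
  have hne : ∀ w ∈ D, (‖e w‖ : ℂ) ≠ 0 := fun w hw => by
    simp only [he, rieszCLM_apply, ne_eq, Complex.ofReal_eq_zero, norm_eq_zero,
      EmbeddingLike.map_eq_zero_iff]
    exact h0 w hw
  have hself : ∀ w, inner ℂ (e w) (e w) = (‖e w‖ : ℂ) ^ 2 := fun w => inner_self_eq_norm_sq_to_K _
  have hat : ∀ w ∈ D, DifferentiableAt ℂ δ w := fun w hw => (hδ w hw).differentiableAt (hD.mem_nhds hw)
  -- The map `e` is antiholomorphic and the inner product is antilinear in its first slot. Hence
  -- `∂/∂z̄` acts on the second slot only, and `∂/∂z` on the first.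
  have hfirst : ∀ w ∈ D, wirtingerDBar k F w
      = inner ℂ (e w) (rieszCLM H (fderiv ℂ δ w (Pi.single k 1))) * (inner ℂ (e w) (e w))⁻¹ := by
    intro w hw
    obtain ⟨L, hL, hLv⟩ := hasFDerivAt_inner_complex (hasFDerivAt_rieszCLM (hat w hw))
      (hasFDerivAt_rieszCLM (hat w hw))
    have hslit : inner ℂ (e w) (e w) ∈ Complex.slitPlane := by
      rw [hself, ← Complex.ofReal_pow]
      refine Complex.ofReal_mem_slitPlane.2 (pow_pos (norm_pos_iff.2 fun h => ?_) 2)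
      exact hne w hw (by rw [h, norm_zero, Complex.ofReal_zero])
    have hlog := ((Complex.hasDerivAt_log hslit).hasFDerivAt.restrictScalars ℝ).comp w hL
    have hev : F =ᶠ[𝓝 w] fun x => Complex.log (inner ℂ (e x) (e x)) := by
      filter_upwards [hD.mem_nhds hw] with x hx
      rw [hF x hx, hself, ← Complex.ofReal_pow, Complex.ofReal_log (by positivity)]
    rw [wirtingerDBar_eq (hlog.congr_of_eventuallyEq hev)]
    simp only [ContinuousLinearMap.comp_apply, ContinuousLinearMap.coe_restrictScalars', hLv,
      map_smul, rieszCLM_smul, inner_smul_left, inner_smul_right, Complex.conj_I,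
      ContinuousLinearMap.toSpanSingleton_apply, smul_eq_mul, map_neg]
    linear_combination (1 / 2 * inner ℂ (rieszCLM H (fderiv ℂ δ w (Pi.single k 1))) (e w)
      * (inner ℂ (e w) (e w))⁻¹ - 1 / 2 * inner ℂ (e w) (rieszCLM H (fderiv ℂ δ w (Pi.single k 1)))
      * (inner ℂ (e w) (e w))⁻¹) * Complex.I_sq
  have hat' : DifferentiableAt ℂ (fun w => fderiv ℂ δ w (Pi.single k 1)) z :=
    (hδ.fderiv_apply_of_complex hD _ z hz).differentiableAt (hD.mem_nhds hz)
  obtain ⟨L, hL, hLv⟩ := hasFDerivAt_inner_complex (hasFDerivAt_rieszCLM (hat z hz))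
    (hasFDerivAt_rieszCLM (hat z hz))
  obtain ⟨M, hM, hMv⟩ := hasFDerivAt_inner_complex (hasFDerivAt_rieszCLM (hat z hz))
    (hasFDerivAt_rieszCLM hat')
  have hg0 : inner ℂ (e z) (e z) ≠ (0 : ℂ) := by
    rw [hself]; exact pow_ne_zero 2 (hne z hz)
  have hinv := ((hasDerivAt_inv hg0).hasFDerivAt.restrictScalars ℝ).comp z hL
  have hq := hM.mul hinv
  have hev : wirtingerDBar k F =ᶠ[𝓝 z] fun w =>
      inner ℂ (e w) (rieszCLM H (fderiv ℂ δ w (Pi.single k 1))) * (inner ℂ (e w) (e w))⁻¹ :=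
    eventually_of_mem (hD.mem_nhds hz) hfirst
  rw [wirtingerD_eq (hq.congr_of_eventuallyEq hev)]
  simp only [ContinuousLinearMap.comp_apply, ContinuousLinearMap.coe_restrictScalars', hLv, hMv,
    map_smul, rieszCLM_smul, inner_smul_left, inner_smul_right, Complex.conj_I,
    ContinuousLinearMap.toSpanSingleton_apply, smul_eq_mul, map_neg,
    add_apply, smul_apply, Function.comp_apply]
  have hz2 : inner ℂ (rieszCLM H (δ z)) (rieszCLM H (δ z)) = (‖rieszCLM H (δ z)‖ : ℂ) ^ 2 := hself z
  have hz0 : (‖rieszCLM H (δ z)‖ : ℂ) ≠ 0 := hne z hz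
  simp only [he, hz2]
  field_simp
  ring_nf
  simp only [Complex.I_sq]
  ring

/-- The Riesz map is antilinear, so expanding the derivative along `u` puts `u j` in the first slot
and `conj (u k)` in the second. The result is the Cauchy–Schwarz defect of `e` and its derivative,
divided by `‖e‖ ^ 4`. -/
theorem sum_wirtinger_log_norm_sq {D : Set (Fin n → ℂ)} (hD : IsOpen D)
    {δ : (Fin n → ℂ) → StrongDual ℂ H} (hδ : DifferentiableOn ℂ δ D)
    (h0 : ∀ w ∈ D, δ w ≠ 0) {F : (Fin n → ℂ) → ℂ}
    (hF : ∀ w ∈ D, F w = (Real.log (‖rieszCLM H (δ w)‖ ^ 2) : ℂ)) (hz : z ∈ D) (u : Fin n → ℂ) :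
    ∑ j, ∑ k, wirtingerD j (wirtingerDBar k F) z * u j * conj (u k)
      = ((‖rieszCLM H (fderiv ℂ δ z u)‖ ^ 2 / ‖rieszCLM H (δ z)‖ ^ 2
        - ‖inner ℂ (rieszCLM H (δ z)) (rieszCLM H (fderiv ℂ δ z u))‖ ^ 2
          / ‖rieszCLM H (δ z)‖ ^ 4 : ℝ) : ℂ) := by
  have hu : rieszCLM H (fderiv ℂ δ z u)
      = ∑ j, conj (u j) • rieszCLM H (fderiv ℂ δ z (Pi.single j 1)) := by
    conv_lhs => rw [pi_eq_sum_univ' u]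
    simp only [map_sum, map_smul, rieszCLM_smul]
  set e := rieszCLM H (δ z)
  set a : Fin n → H := fun j => rieszCLM H (fderiv ℂ δ z (Pi.single j 1)) with ha
  set b := rieszCLM H (fderiv ℂ δ z u)
  have h1 : (‖b‖ : ℂ) ^ 2 = ∑ j, ∑ k, inner ℂ (a j) (a k) * u j * conj (u k) := by
    rw [← Complex.coe_algebraMap, ← inner_self_eq_norm_sq_to_K (𝕜 := ℂ) b, hu, sum_inner]
    refine Finset.sum_congr rfl fun j _ => ?_
    rw [inner_sum]
    refine Finset.sum_congr rfl fun k _ => ?_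
    simp only [inner_smul_left, inner_smul_right, ha]
    simp
    ring
  have h2 : inner ℂ b e = ∑ j, u j * inner ℂ (a j) e := by
    rw [hu, sum_inner]
    refine Finset.sum_congr rfl fun j _ => ?_
    simp [inner_smul_left, ha]
  have h3 : inner ℂ e b = ∑ j, conj (u j) * inner ℂ e (a j) := by
    rw [hu, inner_sum]
    refine Finset.sum_congr rfl fun j _ => ?_
    simp [inner_smul_right, ha]
  have h4 : (‖inner ℂ e b‖ : ℂ) ^ 2 = ∑ j, ∑ k, inner ℂ e (a k) * inner ℂ (a j) e * u j * conj (u k) := by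
    rw [← Complex.mul_conj', inner_conj_symm, mul_comm, h2, h3, Finset.sum_mul_sum]
    refine Finset.sum_congr rfl fun j _ => Finset.sum_congr rfl fun k _ => ?_
    ring
  push_cast
  rw [h1, h4, Finset.sum_div, Finset.sum_div, ← Finset.sum_sub_distrib]
  refine Finset.sum_congr rfl fun j _ => ?_
  rw [Finset.sum_div, Finset.sum_div, ← Finset.sum_sub_distrib]
  refine Finset.sum_congr rfl fun k _ => ?_
  rw [wirtingerD_wirtingerDBar_log_norm_sq hD hδ h0 hF hz]
  simp only [ha, e]
  ring

end LeviForm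

/-! ### Lower bound for the Bergman metric -/

section MetricLowerBound

/-- Cauchy-Schwarz for a vector orthogonal to `e`. -/
theorem norm_inner_sq_le_of_inner_eq_zero {H : Type*} [NormedAddCommGroup H]
    [InnerProductSpace ℂ H] {e b h : H} (he : e ≠ 0) (heh : inner ℂ e h = 0) :
    ‖inner ℂ b h‖ ^ 2 ≤ ‖h‖ ^ 2 * (‖b‖ ^ 2 - ‖inner ℂ e b‖ ^ 2 / ‖e‖ ^ 2) := by
  have hen : (‖e‖ : ℂ) ≠ 0 := by simpa using he
  have hen' : ‖e‖ ≠ 0 := by simpa using he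
  set c : ℂ := inner ℂ e b / (‖e‖ : ℂ) ^ 2 with hc
  set b' := b - c • e with hb'
  have hself : inner ℂ e e = (‖e‖ : ℂ) ^ 2 := inner_self_eq_norm_sq_to_K e
  have h1 : inner ℂ (c • e) b' = 0 := by
    rw [hb', inner_smul_left, inner_sub_right, inner_smul_right, hself, hc,
      div_mul_cancel₀ _ (pow_ne_zero 2 hen), sub_self, mul_zero]
  have h2 : ‖b‖ ^ 2 = ‖inner ℂ e b‖ ^ 2 / ‖e‖ ^ 2 + ‖b'‖ ^ 2 := by
    have := norm_add_sq_eq_norm_sq_add_norm_sq_of_inner_eq_zero (c • e) b' h1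
    rw [hb', add_sub_cancel] at this
    have hcn : ‖c‖ = ‖inner ℂ e b‖ / ‖e‖ ^ 2 := by
      rw [hc, norm_div, norm_pow, Complex.norm_real, norm_norm]
    rw [pow_two, this, norm_smul, hcn, hb']
    field_simp
  have h3 : inner ℂ b h = inner ℂ b' h := by
    rw [hb', inner_sub_left, inner_smul_left, heh, mul_zero, sub_zero]
  rw [h3, h2, add_sub_cancel_left, ← mul_pow, mul_comm]
  exact pow_le_pow_left₀ (norm_nonneg _) (norm_inner_le_norm _ _) 2

theorem apply_rieszCLM_self {H : Type*} [NormedAddCommGroup H] [InnerProductSpace ℂ H]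
    [CompleteSpace H] (x : StrongDual ℂ H) : x (rieszCLM H x) = (‖rieszCLM H x‖ : ℂ) ^ 2 := by
  rw [← inner_rieszCLM_left, inner_self_eq_norm_sq_to_K]; rfl

theorem rieszCLM_ne_zero {H : Type*} [NormedAddCommGroup H] [InnerProductSpace ℂ H]
    [CompleteSpace H] {x : StrongDual ℂ H} (hx : x ≠ 0) : rieszCLM H x ≠ 0 := by
  rwa [rieszCLM_apply, ne_eq, EmbeddingLike.map_eq_zero_iff]

/-- A vector `h` killed by `δ z` is orthogonal to the Riesz vector `e`, so it only pairs with the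
part of the derivative orthogonal to `e`. The squared length of that part is `‖e‖ ^ 2` times the
Levi form. -/
theorem norm_fderiv_apply_sq_le {H : Type*} [NormedAddCommGroup H] [InnerProductSpace ℂ H]
    [CompleteSpace H] {n : ℕ} {D : Set (Fin n → ℂ)} (hD : IsOpen D)
    {δ : (Fin n → ℂ) → StrongDual ℂ H} (hδ : DifferentiableOn ℂ δ D)
    (h0 : ∀ w ∈ D, δ w ≠ 0) {F : (Fin n → ℂ) → ℂ}
    (hF : ∀ w ∈ D, F w = (Real.log (δ w (rieszCLM H (δ w))).re : ℂ)) {z : Fin n → ℂ} (hz : z ∈ D)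
    (u : Fin n → ℂ) :
    0 ≤ (∑ j, ∑ k, wirtingerD j (wirtingerDBar k F) z * u j * conj (u k)).re ∧
    ∀ h : H, δ z h = 0 → ‖fderiv ℂ δ z u h‖ ^ 2 ≤ ‖h‖ ^ 2 * ‖rieszCLM H (δ z)‖ ^ 2
      * (∑ j, ∑ k, wirtingerD j (wirtingerDBar k F) z * u j * conj (u k)).re := by
  have hF' : ∀ w ∈ D, F w = (Real.log (‖rieszCLM H (δ w)‖ ^ 2) : ℂ) := fun w hw => by
    rw [hF w hw, apply_rieszCLM_self, ← Complex.ofReal_pow, Complex.ofReal_re]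
  rw [sum_wirtinger_log_norm_sq hD hδ h0 hF' hz u, Complex.ofReal_re]
  have hene : rieszCLM H (δ z) ≠ 0 := rieszCLM_ne_zero (h0 z hz)
  have hen : 0 < ‖rieszCLM H (δ z)‖ := norm_pos_iff.2 hene
  constructor
  · rw [sub_nonneg, div_le_div_iff₀ (by positivity) (by positivity)]
    have := pow_le_pow_left₀ (norm_nonneg _)
      (norm_inner_le_norm (𝕜 := ℂ) (rieszCLM H (δ z)) (rieszCLM H (fderiv ℂ δ z u))) 2
    calc _ ≤ _ := mul_le_mul_of_nonneg_right this (by positivity)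
      _ = _ := by ring
  · intro h hh
    have key := norm_inner_sq_le_of_inner_eq_zero (b := rieszCLM H (fderiv ℂ δ z u)) (h := h) hene
      (by rw [inner_rieszCLM_left, hh])
    rw [inner_rieszCLM_left] at key
    refine key.trans (le_of_eq ?_)
    field_simp

/-- The Bergman metric dominates the derivatives of bounded holomorphic functions. -/
theorem norm_fderiv_sq_le_bergmanMetric {n : ℕ} {D : Set (Fin n → ℂ)} (hD : IsOpen D)
    (hDb : Bornology.IsBounded D) {g : (Fin n → ℂ) → ℂ} (hg : DifferentiableOn ℂ g D)
    {z : Fin n → ℂ} (hz : z ∈ D) {M : ℝ} (hM : ∀ w ∈ D, ‖g w - g z‖ ≤ M) (u : Fin n → ℂ) :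
    ‖fderiv ℂ g z u‖ ^ 2 ≤ 2 * M ^ 2 * (bergmanMetric D z u u).re := by
  have := bergmanSpace.completeSpace hD
  obtain ⟨δ, hδ, hδr⟩ := bergmanSpace.exists_evaluation hD
  have hM0 : 0 ≤ M := (norm_nonneg _).trans (hM z hz)
  have hfin : IsFiniteMeasure (volume.restrict D) := ⟨by
    rw [Measure.restrict_apply_univ]; exact hDb.measure_lt_top⟩
  -- Since `D` is bounded, constants are square integrable, so no evaluation functional vanishes and
  -- `K(w,w) > 0`.
  have h1 : MemBergmanSpace D (fun _ => 1) := ⟨differentiableOn_const 1, memLp_const 1⟩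
  have h0 : ∀ w ∈ D, δ w ≠ 0 := fun w hw h => by
    have := hδr w hw (bergmanSpace.ofMem h1)
    rw [h, bergmanSpace.rep_ofMem hD h1 hw] at this
    simp at this
  have hF : ∀ w ∈ D, (Real.log (bergmanKernel D w w).re : ℂ)
      = (Real.log (δ w (rieszCLM (bergmanSpace D) (δ w))).re : ℂ) := by
    intro w hw
    rw [bergmanKernel_eq_rep hD hδr hw hw, ← rieszCLM_apply, ← hδr w hw]
  have hmet : (bergmanMetric D z u u).re = (1 / 2) * (∑ j, ∑ k, wirtingerD j (wirtingerDBar k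
      fun w => (Real.log (bergmanKernel D w w).re : ℂ)) z * u j * conj (u k)).re := by
    rw [bergmanMetric]
    have : (1 / 2 : ℂ) = ((1 / 2 : ℝ) : ℂ) := by push_cast; rfl
    rw [this, Complex.re_ofReal_mul]
  obtain ⟨hS, key⟩ := norm_fderiv_apply_sq_le hD hδ h0 hF hz u
  set S := (∑ j, ∑ k, wirtingerD j (wirtingerDBar k
      fun w => (Real.log (bergmanKernel D w w).re : ℂ)) z * u j * conj (u k)).re
  set e := rieszCLM (bergmanSpace D) (δ z) with he
  have hee : bergmanSpace.rep e z = (‖e‖ : ℂ) ^ 2 := by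
    rw [← hδr z hz]; exact apply_rieszCLM_self (δ z)
  have hene : e ≠ 0 := rieszCLM_ne_zero (h0 z hz)
  have hen : 0 < ‖e‖ := norm_pos_iff.2 hene
  have hre := bergmanSpace.memBergmanSpace_rep e
  have hbound : ∀ᵐ w ∂volume.restrict D,
      ‖(g w - g z) * bergmanSpace.rep e w‖ ≤ M * ‖bergmanSpace.rep e w‖ := by
    filter_upwards [ae_restrict_mem hD.measurableSet] with w hw
    rw [norm_mul]
    exact mul_le_mul_of_nonneg_right (hM w hw) (norm_nonneg _)
  -- The test function `(g - g z) e` vanishes at `z`, has norm at most `M ‖e‖`, and has derivative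
  -- `‖e‖ ^ 2 * fderiv ℂ g z u` there. The factor 2 in the conclusion undoes the `½` in the metric.
  have hdh : DifferentiableOn ℂ (fun w => (g w - g z) * bergmanSpace.rep e w) D :=
    (hg.sub_const _).mul hre.1
  have hh : MemBergmanSpace D (fun w => (g w - g z) * bergmanSpace.rep e w) :=
    ⟨hdh, hre.2.of_le_mul (hdh.continuousOn.aestronglyMeasurable hD.measurableSet) hbound⟩
  have hrh := bergmanSpace.rep_ofMem hD hh
  set h := bergmanSpace.ofMem hh
  have hnorm : ‖h‖ ≤ M * ‖e‖ := by
    refine Lp.norm_le_mul_norm_of_ae_le_mul (f := h.1) (g := e.1) ?_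
    filter_upwards [hbound, bergmanSpace.coeFn_ae_eq_rep h, bergmanSpace.coeFn_ae_eq_rep e,
      ae_restrict_mem hD.measurableSet] with w hw h1 h2 hwD
    rw [h1, h2, hrh hwD]
    exact hw
  have hδz : DifferentiableAt ℂ δ z := (hδ z hz).differentiableAt (hD.mem_nhds hz)
  have hgz : DifferentiableAt ℂ g z := (hg z hz).differentiableAt (hD.mem_nhds hz)
  have hrz : DifferentiableAt ℂ (bergmanSpace.rep e) z :=
    (hre.1 z hz).differentiableAt (hD.mem_nhds hz)
  have hbh : fderiv ℂ δ z u h = fderiv ℂ g z u * (‖e‖ : ℂ) ^ 2 := by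
    have e1 := (hδz.hasFDerivAt.clm_apply (hasFDerivAt_const h z))
    have e2 := (hgz.hasFDerivAt.sub_const (g z)).mul hrz.hasFDerivAt
    have e3 : (fun w => δ w h) =ᶠ[𝓝 z] (fun w => (g w - g z) * bergmanSpace.rep e w) :=
      eventually_of_mem (hD.mem_nhds hz) fun w hw => by
        change δ w h = _
        rw [hδr w hw, hrh hw]
    have e4 := congrArg (fun L => L u) (e1.unique (e2.congr_of_eventuallyEq e3))
    simp only [ContinuousLinearMap.comp_zero, zero_add, ContinuousLinearMap.flip_apply, sub_self,
      hee] at e4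
    have e5 : fderiv ℂ δ z u h = 0 * fderiv ℂ (bergmanSpace.rep e) z u
        + (‖e‖ : ℂ) ^ 2 * fderiv ℂ g z u := e4
    rw [e5]
    ring
  have hhz : δ z h = 0 := by
    rw [hδr z hz, hrh hz]
    exact mul_eq_zero_of_left (sub_self _) _
  have key1 := key h hhz
  rw [hbh, norm_mul, norm_pow, Complex.norm_real, norm_norm] at key1
  have key2 : ‖h‖ ^ 2 * ‖e‖ ^ 2 * S ≤ (M * ‖e‖) ^ 2 * ‖e‖ ^ 2 * S := by gcongr
  rw [hmet]
  have hen4 : 0 < ‖e‖ ^ 4 := pow_pos hen 4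
  refine le_of_mul_le_mul_right (a := ‖e‖ ^ 4) ?_ hen4
  calc _ = (‖fderiv ℂ g z u‖ * ‖e‖ ^ 2) ^ 2 := by ring
    _ ≤ _ := key1.trans key2
    _ = _ := by ring

end MetricLowerBound

/-! ### The Fredholm alternative without completeness -/

section Fredholm

variable {X : Type*} [NormedAddCommGroup X] [NormedSpace ℂ X] {T : X →L[ℂ] X} {μ : ℂ}

open Module End

/-- In an incomplete space a lower bound does not make the image closed; compactness supplies the
limit. Writing `x = μ⁻¹ (T x - (T - μ) x)`, a subsequence along which `T x` converges makes `x`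
itself converge. -/
theorem IsCompactOperator.isClosedEmbedding_sub_smul (hT : IsCompactOperator T) (hμ : μ ≠ 0)
    (h : ¬ HasEigenvalue (T : End ℂ X) μ) :
    Topology.IsClosedEmbedding (T - μ • 1 : X →L[ℂ] X) := by
  obtain ⟨K, hK⟩ := hT.antilipschitz_of_not_hasEigenvalue hμ h
  refine .of_continuous_injective_isClosedMap (ContinuousLinearMap.continuous _) hK.injective
    fun C hC => ?_
  refine IsSeqClosed.isClosed fun y b hy hb => ?_
  choose x hxC hxy using hy
  have hbd : Bornology.IsBounded (Set.range x) := by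
    refine (hK.isBounded_preimage (Metric.isBounded_range_of_tendsto y hb)).subset ?_
    rintro _ ⟨i, rfl⟩
    exact ⟨i, (hxy i).symm⟩
  obtain ⟨R, hR⟩ := hbd.exists_norm_le
  obtain ⟨L, hL, hL'⟩ := hT.image_closedBall_subset_compact R
  obtain ⟨t, -, φ, hφ, ht⟩ := hL.tendsto_subseq (x := fun i => T (x i))
    fun i => hL' ⟨x i, by simpa using hR _ ⟨i, rfl⟩, rfl⟩
  have hx : Tendsto (x ∘ φ) atTop (𝓝 (μ⁻¹ • (t - b))) := by
    refine ((ht.sub (hb.comp hφ.tendsto_atTop)).const_smul μ⁻¹).congr fun i => ?_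
    simp only [Function.comp_apply, ← hxy]
    simp [hμ]
  refine ⟨_, hC.mem_of_tendsto hx (Eventually.of_forall fun i => hxC _), ?_⟩
  refine tendsto_nhds_unique ((ContinuousLinearMap.continuous _).tendsto _ |>.comp hx)
    ((hb.comp hφ.tendsto_atTop).congr fun i => (hxy (φ i)).symm)

/-- The Fredholm alternative on a normed space that need not be complete. -/
theorem IsCompactOperator.surjective_sub_smul (hT : IsCompactOperator T) (hμ : μ ≠ 0)
    (h : ¬ HasEigenvalue (T : End ℂ X) μ) :
    Function.Surjective (T - μ • 1 : X →L[ℂ] X) := by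
  by_contra hsurj
  have hemb := hT.isClosedEmbedding_sub_smul hμ h
  set S : X →L[ℂ] X := T - μ • 1 with hS
  -- If `S` is injective but not onto, its iterated ranges form a strictly decreasing chain of
  -- closed subspaces. Riesz's lemma picks a bounded `x n ∈ V n` at distance at least 1 from `V (n +
  -- 1)`.
  let V : ℕ → Submodule ℂ X := fun n => LinearMap.range ((S : End ℂ X) ^ n)
  have hVmap : ∀ n, V (n + 1) = (V n).map (S : End ℂ X) := fun n => by
    simp only [V]
    rw [pow_succ', Module.End.mul_eq_comp, LinearMap.range_comp]
  have hVcl : ∀ n, IsClosed (V n : Set X) := by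
    intro n
    induction n with
    | zero => simp [V, Module.End.one_eq_id]
    | succ n ih =>
      rw [hVmap, Submodule.map_coe]
      exact hemb.isClosedMap _ ih
  have hVanti : Antitone V := antitone_nat_of_succ_le fun n => by
    simp only [V]
    rw [pow_succ, Module.End.mul_eq_comp]
    exact LinearMap.range_comp_le_range _ _
  have hinj : ∀ n, Function.Injective ((S : End ℂ X) ^ n : End ℂ X) := fun n => by
    rw [Module.End.coe_pow]
    exact hemb.injective.iterate n
  have hx : ∀ n, ∃ x ∈ V n, ‖x‖ ≤ 3 ∧ ∀ y ∈ V (n + 1), 1 ≤ ‖x - y‖ := by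
    intro n
    have h1 : IsClosed ((V (n + 1)).comap (V n).subtype : Set (V n)) :=
      (hVcl (n + 1)).preimage continuous_subtype_val
    have h2 : ∃ x : V n, x ∉ (V (n + 1)).comap (V n).subtype := by
      by_contra hcon
      push Not at hcon
      refine hsurj fun a => ?_
      obtain ⟨b, hb⟩ := hcon ⟨((S : End ℂ X) ^ n) a, a, rfl⟩
      rw [pow_succ, Module.End.mul_eq_comp] at hb
      exact ⟨b, hinj n hb⟩
    obtain ⟨⟨x, hx⟩, hxn, hxy⟩ := riesz_lemma_of_norm_lt (c := (2 : ℂ)) (R := 3) (by simp)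
      (by simp; norm_num) h1 h2
    exact ⟨x, hx, hxn, fun y hy => hxy ⟨y, hVanti (Nat.le_succ n) hy⟩ hy⟩
  choose x hxV hx3 hxd using hx
  have hSV : ∀ n, ∀ a ∈ V n, S a ∈ V (n + 1) := fun n a ha => by
    rw [hVmap]; exact ⟨a, ha, rfl⟩
  -- For `m < n`, `T (x m) - T (x n)` is `μ` times the difference of `x m` and an element of `V (m +
  -- 1)`, so no subsequence of `T (x n)` is Cauchy.
  have hsep : ∀ m n, m < n → ‖μ‖ ≤ ‖T (x m) - T (x n)‖ := by
    intro m n hmn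
    have hn : x n ∈ V (m + 1) := hVanti hmn (hxV n)
    have hy : μ⁻¹ • (S (x n) - S (x m)) + x n ∈ V (m + 1) :=
      (V (m + 1)).add_mem ((V (m + 1)).smul_mem _ ((V (m + 1)).sub_mem
        (hVanti (Nat.le_succ _) (hSV _ _ hn)) (hSV _ _ (hxV m)))) hn
    have := hxd m _ hy
    have e : T (x m) - T (x n) = μ • (x m - (μ⁻¹ • (S (x n) - S (x m)) + x n)) := by
      rw [smul_sub, smul_add, smul_inv_smul₀ hμ]
      simp only [hS, sub_apply, smul_apply, one_apply_eq_self]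
      module
    rw [e, norm_smul]
    exact le_mul_of_one_le_right (norm_nonneg _) this
  obtain ⟨L, hL, hL'⟩ := hT.image_closedBall_subset_compact 3
  obtain ⟨t, -, φ, hφ, ht⟩ := hL.tendsto_subseq (x := fun i => T (x i))
    fun i => hL' ⟨x i, by simpa using hx3 i, rfl⟩
  obtain ⟨N, hN⟩ := Metric.cauchySeq_iff'.1 ht.cauchySeq ‖μ‖ (norm_pos_iff.2 hμ)
  have h1 := hN (N + 1) (Nat.le_succ N)
  rw [dist_comm, dist_eq_norm] at h1
  exact h1.not_ge (hsep _ _ (hφ (Nat.lt_succ_self N)))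

end Fredholm

/-! ### Compact multipliers vanish -/

namespace BoundedHomogeneousDomain

variable {n : ℕ} {D : BoundedHomogeneousDomain n} {z₀ : D.carrier}

/-- A compact multiplication operator on an infinite-dimensional subspace of the Bloch space that
contains the constants has symbol zero. -/
theorem IsCompactMultiplication.eq_zero {ψ : D.carrier → ℂ} (hψ : D.Holo ψ)
    {X : Submodule ℂ (D.BlochSpace z₀)} (hone : ∃ f ∈ X, f.toFun = 1)
    (hX : ¬ FiniteDimensional ℂ X) (h : IsCompactMultiplication ψ X) : ψ = 0 := by
  obtain ⟨T, hTmul, hT⟩ := h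
  by_contra hne
  obtain ⟨z, hz⟩ := Function.ne_iff.1 hne
  have hμ : ψ z ≠ 0 := hz
  by_cases hev : Module.End.HasEigenvalue (T : Module.End ℂ X) (ψ z)
  -- Near a point where the eigenfunction is nonzero, `ψ` equals `ψ z`; hence it does so on all of
  -- `D`, and `T` is a nonzero multiple of the identity.
  · obtain ⟨f, hf⟩ := hev.exists_hasEigenvector
    have hTf : T f = ψ z • f := hf.apply_eq_smul
    obtain ⟨p, hp⟩ : ∃ p, (f : D.BlochSpace z₀).toFun p ≠ 0 := by
      by_contra hcon
      push Not at hcon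
      exact hf.2 (Subtype.ext (Subtype.ext (funext hcon)))
    have hmul : ∀ w, ψ w * (f : D.BlochSpace z₀).toFun w
        = ψ z * (f : D.BlochSpace z₀).toFun w := fun w => by
      have := congrFun (hTmul f) w
      rw [hTf] at this
      exact this.symm
    have hzero := eqOn_zero_of_eventuallyEq_zero_of_complex (f := fun w => D.extend ψ w - ψ z)
      (DifferentiableOn.sub_const hψ _) D.isOpen D.isConnected.isPreconnected p.2 (by
        have hc := ((f : D.BlochSpace z₀).holo.differentiableAt p.2).continuousAt
        have h0 : D.extend (f : D.BlochSpace z₀).toFun p ≠ 0 := by rwa [extend_apply]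
        filter_upwards [hc.eventually_ne h0, D.isOpen.mem_nhds p.2] with w hw hwD
        have e := hmul ⟨w, hwD⟩
        rw [← D.extend_apply (f : D.BlochSpace z₀).toFun ⟨w, hwD⟩] at e
        have := mul_right_cancel₀ hw e
        rw [← D.extend_apply ψ ⟨w, hwD⟩] at this
        exact sub_eq_zero.2 this)
    have hconst : ∀ w : D.carrier, ψ w = ψ z := fun w => by
      have := hzero w w.2
      rwa [extend_apply, sub_eq_zero] at this
    have hTid : ∀ g, T g = ψ z • g := fun g => by
      refine Subtype.ext (Subtype.ext ((hTmul g).trans (funext fun w => ?_)))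
      rw [Pi.mul_apply, hconst w]
      rfl
    have hid : (id : X → X) = (ψ z)⁻¹ • ⇑T := by
      funext g
      simp [hTid g, hμ]
    have hcomp : IsCompactOperator (id : X → X) := by
      rw [hid]
      exact hT.smul (ψ z)⁻¹
    exact hX (FiniteDimensional.of_isCompactOperator_id hcomp)
  -- Otherwise `(ψ - ψ z) f = 1` is solvable in `X`, which is absurd at `z`.
  · obtain ⟨g, hgX, hg⟩ := hone
    obtain ⟨f, hf⟩ := hT.surjective_sub_smul hμ hev ⟨g, hgX⟩
    have h1 : (T f : D.BlochSpace z₀).toFun z - ψ z * (f : D.BlochSpace z₀).toFun z = 1 := by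
      have := congrArg (fun k : X => (k : D.BlochSpace z₀).toFun z) hf
      simp only [hg, Pi.one_apply] at this
      exact this
    rw [hTmul f, Pi.mul_apply, sub_self] at h1
    exact zero_ne_one h1

theorem isCompactMultiplication_zero (X : Submodule ℂ (D.BlochSpace z₀)) :
    IsCompactMultiplication (0 : D.carrier → ℂ) X :=
  ⟨0, fun f => by rw [zero_mul]; rfl, isCompactOperator_zero⟩

end BoundedHomogeneousDomain

/-! ### Bounded holomorphic functions and polynomials in the Bloch space -/

namespace BoundedHomogeneousDomain

variable {n : ℕ} {D : BoundedHomogeneousDomain n} {z₀ : D.carrier}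

theorem extend_restrict_eqOn (g : (Fin n → ℂ) → ℂ) :
    Set.EqOn (D.extend fun w => g w) g D.carrier := fun z hz => D.extend_apply _ ⟨z, hz⟩

theorem holo_restrict {g : (Fin n → ℂ) → ℂ} (hg : DifferentiableOn ℂ g D.carrier) :
    D.Holo fun w => g w := hg.congr (extend_restrict_eqOn g)

theorem fderiv_extend_restrict (g : (Fin n → ℂ) → ℂ) {z : Fin n → ℂ} (hz : z ∈ D.carrier) :
    fderiv ℂ (D.extend fun w => g w) z = fderiv ℂ g z := by
  have : (D.extend fun w => g w) =ᶠ[𝓝 z] g :=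
    eventually_of_mem (D.isOpen.mem_nhds hz) (extend_restrict_eqOn g)
  exact this.fderiv_eq

/-- The product form also covers a vanishing denominator: the numerator then vanishes, and `0 / 0 =
0` in `ℝ≥0∞`. -/
theorem Q_le_of_norm_fderiv_le {f : D.carrier → ℂ} {z : Fin n → ℂ} {c : ℝ}
    (h : ∀ u, ‖fderiv ℂ (D.extend f) z u‖ ≤ c * √(bergmanMetric D.carrier z u u).re) :
    D.Q f z ≤ ENNReal.ofReal c := by
  refine iSup₂_le fun u _ => ENNReal.div_le_of_le_mul ?_
  rw [← ENNReal.ofReal_mul' (Real.sqrt_nonneg _), ← ofReal_norm]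
  exact ENNReal.ofReal_le_ofReal (h u)

theorem norm_fderiv_le_mul_sqrt_bergmanMetric {g : (Fin n → ℂ) → ℂ}
    (hg : DifferentiableOn ℂ g D.carrier) {M : ℝ} (hM : ∀ w ∈ D.carrier, ‖g w‖ ≤ M)
    {z : Fin n → ℂ} (hz : z ∈ D.carrier) (u : Fin n → ℂ) :
    ‖fderiv ℂ g z u‖ ≤ 4 * M * √(bergmanMetric D.carrier z u u).re := by
  have hM0 : 0 ≤ M := (norm_nonneg _).trans (hM z hz)
  -- The oscillation around `g z` is at most `2M`, giving `8 M ^ 2`, which is rounded up to `(4M) ^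
  -- 2`.
  have h := norm_fderiv_sq_le_bergmanMetric D.isOpen D.isBounded hg hz (M := 2 * M)
    (fun w hw => (norm_sub_le _ _).trans (by linarith [hM w hw, hM z hz])) u
  by_cases hH : 0 ≤ (bergmanMetric D.carrier z u u).re
  · refine abs_le_of_sq_le_sq' ?_ (by positivity) |>.2
    rw [mul_pow, Real.sq_sqrt hH]
    nlinarith [mul_nonneg (sq_nonneg M) hH]
  · have h1 : ‖fderiv ℂ g z u‖ ^ 2 ≤ 0 := h.trans
      (mul_nonpos_of_nonneg_of_nonpos (by positivity) (not_le.1 hH).le)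
    rw [pow_eq_zero_iff two_ne_zero |>.1 (le_antisymm h1 (sq_nonneg _))]
    positivity

/-- Bounded holomorphic functions are Bloch functions. -/
theorem restrict_mem_blochSubmodule {g : (Fin n → ℂ) → ℂ} (hg : DifferentiableOn ℂ g D.carrier)
    {M : ℝ} (hM : ∀ w ∈ D.carrier, ‖g w‖ ≤ M) : (fun w : D.carrier => g w) ∈ D.blochSubmodule := by
  refine ⟨holo_restrict hg, lt_of_le_of_lt (iSup₂_le fun z hz => ?_)
    (ENNReal.ofReal_lt_top (r := 4 * M))⟩
  refine Q_le_of_norm_fderiv_le fun u => ?_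
  rw [fderiv_extend_restrict g hz]
  exact norm_fderiv_le_mul_sqrt_bergmanMetric hg hM hz u

theorem exists_norm_le_of_continuous {g : (Fin n → ℂ) → ℂ} (hg : Continuous g) :
    ∃ M, ∀ w ∈ D.carrier, ‖g w‖ ≤ M := by
  obtain ⟨M, hM⟩ := D.isBounded.isCompact_closure.exists_bound_of_continuousOn hg.continuousOn
  exact ⟨M, fun w hw => hM w (subset_closure hw)⟩

/-- Polynomials in one coordinate as elements of the Bloch space. -/
noncomputable def polynomialBloch (z₀ : D.carrier) (i : Fin n) :
    Polynomial ℂ →ₗ[ℂ] D.BlochSpace z₀ where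
  toFun P := ⟨fun w => P.eval (w.1 i), by
    have hd : Differentiable ℂ fun w : Fin n → ℂ => P.eval (w i) :=
      P.differentiable.comp (differentiable_apply i)
    obtain ⟨M, hM⟩ := exists_norm_le_of_continuous (D := D) hd.continuous
    exact restrict_mem_blochSubmodule hd.differentiableOn hM⟩
  map_add' P R := Subtype.ext (funext fun w => Polynomial.eval_add)
  map_smul' c P := Subtype.ext (funext fun w => Polynomial.eval_smul _ _ _)

theorem polynomialBloch_toFun (i : Fin n) (P : Polynomial ℂ) (w : D.carrier) :
    (polynomialBloch z₀ i P).toFun w = P.eval (w.1 i) := rfl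

/-- A polynomial in the kernel vanishes on an open slice through `z₀`, hence has infinitely many
roots. -/
theorem polynomialBloch_injective (i : Fin n) :
    Function.Injective (polynomialBloch z₀ i) := by
  rw [← LinearMap.ker_eq_bot, LinearMap.ker_eq_bot']
  intro P hP
  refine Polynomial.eq_zero_of_infinite_isRoot P (infinite_of_mem_nhds (z₀.1 i) ?_)
  have hc : Tendsto (fun t : ℂ => Function.update z₀.1 i t) (𝓝 (z₀.1 i)) (𝓝 z₀.1) := by
    have : Continuous fun t : ℂ => Function.update z₀.1 i t := continuous_const.update i continuous_id
    simpa using this.tendsto (z₀.1 i)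
  filter_upwards [hc (D.isOpen.mem_nhds z₀.2)] with t ht
  have := congrArg (fun f : D.BlochSpace z₀ => f.toFun ⟨_, ht⟩) hP
  simpa [polynomialBloch_toFun, BlochSpace.toFun_zero] using this

theorem not_finiteDimensional_of_polynomialBloch_mem {X : Submodule ℂ (D.BlochSpace z₀)}
    (i : Fin n) (h : ∀ P, polynomialBloch z₀ i P ∈ X) : ¬ FiniteDimensional ℂ X := by
  intro hfin
  refine Polynomial.not_finite (R := ℂ) ?_
  refine Module.Finite.of_injective ((polynomialBloch z₀ i).codRestrict X h) fun P R hPR => ?_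
  exact polynomialBloch_injective i (congrArg Subtype.val hPR)

theorem polynomialBloch_one (i : Fin n) : (polynomialBloch z₀ i 1).toFun = 1 := by
  funext w
  simp [polynomialBloch_toFun]

/-- The constant function one lies in the `*`-little Bloch space. -/
theorem exists_mem_starLittleBloch_eq_one (i : Fin n) :
    ∃ f ∈ starLittleBloch D z₀, f.toFun = 1 := by
  refine ⟨polynomialBloch z₀ i 1, ?_, polynomialBloch_one i⟩
  refine tendsto_const_nhds.congr' ?_
  filter_upwards [mem_inf_of_right (mem_principal_self D.carrier)] with z hz
  refine (le_antisymm ?_ zero_le).symm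
  refine (Q_le_of_norm_fderiv_le (c := 0) fun u => ?_).trans (by simp)
  have := fderiv_extend_restrict (D := D) (fun _ => (1 : ℂ)) hz
  rw [polynomialBloch_one]
  change ‖fderiv ℂ (D.extend fun _ => 1) z u‖ ≤ _
  rw [this]
  simp

end BoundedHomogeneousDomain

/-! ### Harnack's inequality for zero-free functions -/

section ZeroFree

open Metric

/-- Harnack's inequality for the modulus of a zero-free holomorphic function on a disc. -/
theorem norm_pow_three_le_of_ne_zero_disc {p : ℂ → ℂ} {R A : ℝ} (hR : 0 < R)
    (hp : DifferentiableOn ℂ p (ball 0 R)) (hne : ∀ z ∈ ball (0 : ℂ) R, p z ≠ 0)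
    (hA : ∀ z ∈ ball (0 : ℂ) R, ‖p z‖ < A) {z : ℂ} (hz : ‖z‖ ≤ R / 4) :
    ‖p z‖ ^ 3 ≤ ‖p 0‖ * A ^ 2 := by
  have h0 : (0 : ℂ) ∈ ball (0 : ℂ) R := mem_ball_self hR
  have hat : ∀ w ∈ ball (0 : ℂ) R, HasDerivAt p (deriv p w) w := fun w hw =>
    ((hp w hw).differentiableAt (isOpen_ball.mem_nhds hw)).hasDerivAt
  have hq : DifferentiableOn ℂ (fun w => deriv p w / p w) (ball 0 R) :=
    (hp.deriv isOpen_ball).div hp hne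
  -- A primitive of `p' / p` vanishing at 0 is a holomorphic logarithm of `p / p 0`.
  obtain ⟨L, hL0, hL⟩ := hq.isExactOn_ball.with_val_at 0 0
  have hLd : DifferentiableOn ℂ L (ball 0 R) := fun w hw =>
    (hL w hw).differentiableAt.differentiableWithinAt
  have hexp : ∀ w ∈ ball (0 : ℂ) R, p w = p 0 * Complex.exp (L w) := by
    intro w hw
    have hder : ∀ x ∈ ball (0 : ℂ) R, HasDerivAt (fun x => p x * Complex.exp (-L x)) 0 x := by
      intro x hx
      have := (hat x hx).mul ((hL x hx).neg.cexp)
      have hx0 := hne x hx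
      refine this.congr_deriv ?_
      field_simp
      ring
    have := isOpen_ball.is_const_of_deriv_eq_zero (convex_ball (0 : ℂ) R).isPreconnected
      (fun x hx => (hder x hx).differentiableAt.differentiableWithinAt)
      (fun x hx => (hder x hx).deriv) hw h0
    simp only [hL0, neg_zero, Complex.exp_zero, mul_one] at this
    rw [← this, mul_assoc, ← Complex.exp_add, neg_add_cancel, Complex.exp_zero, mul_one]
  have hp0 : 0 < ‖p 0‖ := norm_pos_iff.2 (hne 0 h0)
  have hA0 : 0 < A := hp0.trans (hA 0 h0)
  set M := Real.log (A / ‖p 0‖) with hM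
  have hMpos : 0 < M := Real.log_pos ((one_lt_div hp0).2 (hA 0 h0))
  have hnorm : ∀ w ∈ ball (0 : ℂ) R, ‖p w‖ = ‖p 0‖ * Real.exp (L w).re := fun w hw => by
    rw [hexp w hw, norm_mul, Complex.norm_exp]
  have hre : Set.MapsTo L (ball 0 R) {w | w.re ≤ M} := by
    intro w hw
    have h1 := hA w hw
    rw [hnorm w hw, mul_comm, ← lt_div_iff₀ hp0] at h1
    exact (Real.lt_log_iff_exp_lt (by positivity)).2 h1 |>.le
  have hzb : z ∈ ball (0 : ℂ) R := by rw [mem_ball_zero_iff]; linarith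
  have hbc := Complex.borelCaratheodory_zero hMpos hLd hre hR hzb hL0
  -- For `‖z‖ ≤ R / 4` the Borel–Carathéodory factor `2‖z‖ / (R - ‖z‖)` is at most `2 / 3`; cubing
  -- clears the fractional exponent.
  have hle : (L z).re ≤ 2 / 3 * M := by
    refine (Complex.re_le_norm _).trans (hbc.trans ?_)
    rw [div_le_iff₀ (by linarith)]
    nlinarith
  have hexpM : Real.exp M = A / ‖p 0‖ := Real.exp_log (by positivity)
  have hcube : Real.exp (L z).re ^ 3 ≤ (A / ‖p 0‖) ^ 2 := by
    rw [← hexpM, ← Real.exp_nat_mul, ← Real.exp_nat_mul, Real.exp_le_exp]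
    push_cast
    linarith
  rw [hnorm z hzb, mul_pow]
  calc ‖p 0‖ ^ 3 * Real.exp (L z).re ^ 3 ≤ ‖p 0‖ ^ 3 * (A / ‖p 0‖) ^ 2 := by gcongr
    _ = _ := by field_simp

/-- Harnack's inequality for the modulus of a zero-free holomorphic function on a ball. -/
theorem norm_pow_three_le_of_ne_zero {E : Type*} [NormedAddCommGroup E] [NormedSpace ℂ E]
    {p : E → ℂ} {c : E} {r A : ℝ} (hp : DifferentiableOn ℂ p (ball c r))
    (hne : ∀ z ∈ ball c r, p z ≠ 0) (hA : ∀ z ∈ ball c r, ‖p z‖ < A) {w : E}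
    (hw : w ∈ ball c (r / 4)) : ‖p w‖ ^ 3 ≤ ‖p c‖ * A ^ 2 := by
  have hw' : ‖w - c‖ < r / 4 := by rwa [mem_ball, dist_eq_norm] at hw
  -- Since `‖w - c‖ < r / 4`, the line through `c` and `w` stays in the ball for `‖t‖ < 4`, and `w`
  -- is the point `t = 1 = 4 / 4`.
  have hmaps : ∀ t ∈ ball (0 : ℂ) 4, c + t • (w - c) ∈ ball c r := by
    intro t ht
    rw [mem_ball_zero_iff] at ht
    rw [mem_ball, dist_eq_norm, add_sub_cancel_left, norm_smul]
    nlinarith [norm_nonneg t, norm_nonneg (w - c)]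
  have := norm_pow_three_le_of_ne_zero_disc (p := fun t => p (c + t • (w - c))) (A := A)
    (z := 1) four_pos
    (hp.comp ((differentiable_id.smul_const _).const_add _).differentiableOn hmaps)
    (fun t ht => hne _ (hmaps t ht)) (fun t ht => hA _ (hmaps t ht)) (by simp)
  simpa using this

end ZeroFree

/-! ### Decay at the distinguished boundary -/

/-- The distinguished boundary lies in the topological boundary. -/
theorem distinguishedBoundary_subset_frontier {n : ℕ} (hn : 1 ≤ n) {D : Set (Fin n → ℂ)}
    (hne : D.Nonempty) (hb : Bornology.IsBounded D) : distinguishedBoundary D ⊆ frontier D := by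
  have : Nonempty (Fin n) := ⟨⟨0, hn⟩⟩
  refine Set.sInter_subset_of_mem ⟨isClosed_frontier, frontier_subset_closure, fun h hh => ?_⟩
  obtain ⟨s, hs, hmax⟩ := Complex.exists_mem_frontier_isMaxOn_norm hb hne ⟨hh.2, hh.1⟩
  exact ⟨s, hs, fun z hz => hmax hz⟩

namespace BoundedHomogeneousDomain

open Metric

variable {n : ℕ} {D : BoundedHomogeneousDomain n} {z₀ : D.carrier}

/-- Each coordinate is a bounded holomorphic function. Applied to inverse automorphisms, this takes
the place of the invariance of the Bergman metric. -/
theorem norm_fderiv_apply_le_of_bounded_map {χ : (Fin n → ℂ) → (Fin n → ℂ)}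
    (hχ : DifferentiableOn ℂ χ D.carrier) {M : ℝ} (hM : ∀ w ∈ D.carrier, ‖χ w‖ ≤ M)
    {z : Fin n → ℂ} (hz : z ∈ D.carrier) (u : Fin n → ℂ) :
    ‖fderiv ℂ χ z u‖ ≤ 4 * M * √(bergmanMetric D.carrier z u u).re := by
  have hM0 : 0 ≤ M := (norm_nonneg _).trans (hM z hz)
  refine (pi_norm_le_iff_of_nonneg (by positivity)).2 fun j => ?_
  have hd : DifferentiableAt ℂ χ z := (hχ z hz).differentiableAt (D.isOpen.mem_nhds hz)
  have e : fderiv ℂ χ z u j = fderiv ℂ (fun w => χ w j) z u := by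
    have := (hasFDerivAt_pi'.1 hd.hasFDerivAt j).fderiv
    rw [this]
    rfl
  rw [e]
  exact norm_fderiv_le_mul_sqrt_bergmanMetric (fun w hw => (differentiableWithinAt_pi.1 (hχ w hw)) j)
    (fun w hw => (norm_le_pi_norm _ j).trans (hM w hw)) hz u

/-- If `ζ` is the only zero of a function of `A(D)`, then `Q_g → 0` at `ζ` for all `g ∈ A(D)`. -/
theorem tendsto_Q_restrict {ζ : Fin n → ℂ} (hζ : ζ ∈ frontier D.carrier)
    {h : (Fin n → ℂ) → ℂ} (hh : MemDiskAlgebra D.carrier h)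
    (hzero : ∀ z ∈ closure D.carrier, h z = 0 ↔ z = ζ)
    {g : (Fin n → ℂ) → ℂ} (hg : MemDiskAlgebra D.carrier g) :
    Tendsto (D.Q fun w => g w) (𝓝 ζ ⊓ 𝓟 D.carrier) (𝓝 0) := by
  obtain ⟨z₀, hz₀⟩ := D.isConnected.nonempty
  have hcpt : IsCompact (closure D.carrier) := D.isBounded.isCompact_closure
  have hζc : ζ ∈ closure D.carrier := frontier_subset_closure hζ
  have hζD : ζ ∉ D.carrier := by
    rw [D.isOpen.frontier_eq] at hζ; exact hζ.2
  obtain ⟨r, hr, hrD⟩ := Metric.isOpen_iff.1 D.isOpen z₀ hz₀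
  obtain ⟨A', hA'⟩ := hcpt.exists_bound_of_continuousOn hh.1
  set A := A' + 1
  have hA : ∀ w ∈ D.carrier, ‖h w‖ < A := fun w hw =>
    (hA' w (subset_closure hw)).trans_lt (lt_add_one A')
  have hApos : 0 < A := (norm_nonneg _).trans_lt (hA z₀ hz₀)
  obtain ⟨M', hM'⟩ := D.isBounded.exists_norm_le
  set M := |M'| + 1
  have hM : ∀ w ∈ D.carrier, ‖w‖ ≤ M := fun w hw =>
    (hM' w hw).trans ((le_abs_self M').trans (le_add_of_nonneg_right zero_le_one))
  have hMpos : 0 < M := by positivity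
  -- By compactness `‖h‖` has a positive minimum where `g` is at least `ε` away from `g ζ`, because
  -- `ζ` is not in that set.
  have hsmall : ∀ ε > 0, ∃ η > 0, ∀ w ∈ closure D.carrier, ‖h w‖ < η → ‖g w - g ζ‖ < ε := by
    intro ε hε
    let K : Set (Fin n → ℂ) := closure D.carrier ∩ (fun w => ‖g w - g ζ‖) ⁻¹' Set.Ici ε
    have hKc : IsCompact K := hcpt.of_isClosed_subset
      ((hg.1.sub continuousOn_const).norm.preimage_isClosed_of_isClosed isClosed_closure
        isClosed_Ici) Set.inter_subset_left
    rcases K.eq_empty_or_nonempty with hK | hK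
    · refine ⟨1, one_pos, fun w hw _ => ?_⟩
      by_contra hcon
      have : w ∈ K := ⟨hw, not_lt.1 hcon⟩
      rw [hK] at this
      exact this
    · obtain ⟨w₀, hw₀, hmin⟩ := hKc.exists_isMinOn hK (hh.1.norm.mono Set.inter_subset_left)
      refine ⟨‖h w₀‖, norm_pos_iff.2 fun h0 => ?_, fun w hw hlt => ?_⟩
      · have h1 := (hzero w₀ hw₀.1).1 h0
        have h2 : ε ≤ ‖g w₀ - g ζ‖ := hw₀.2
        rw [h1, sub_self, norm_zero] at h2
        exact h2.not_gt hε
      · by_contra hcon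
        exact (hmin (show w ∈ K from ⟨hw, not_lt.1 hcon⟩)).not_gt hlt
  have key : ∀ ε > 0, ∀ᶠ z in 𝓝 ζ ⊓ 𝓟 D.carrier,
      D.Q (fun w => g w) z ≤ ENNReal.ofReal (2 * ε / (r / 4) * (4 * M)) := by
    intro ε hε
    obtain ⟨η, hη, hηε⟩ := hsmall ε hε
    have hlim : Tendsto h (𝓝 ζ ⊓ 𝓟 D.carrier) (𝓝 0) := by
      have := (hh.1 ζ hζc).mono_left (nhdsWithin_mono ζ subset_closure)
      rwa [(hzero ζ hζc).2 rfl] at this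
    -- With this threshold for `‖h z‖`, Harnack gives `‖h (φ w)‖ ^ 3 < η ^ 3`.
    have hη' : 0 < η ^ 3 / A ^ 2 := by positivity
    filter_upwards [hlim.norm.eventually_lt_const (by rwa [norm_zero]),
      mem_inf_of_right (mem_principal_self D.carrier)] with z hzη hzD
    obtain ⟨φ, ⟨hφ, hφm, χ, hχ, hχm, hχφ, hφχ⟩, hφz⟩ := D.transitive z₀ hz₀ z hzD
    have hχz : χ z = z₀ := by rw [← hφz, hχφ z₀ hz₀]
    have hball : ∀ w ∈ ball z₀ (r / 4), ‖g (φ w) - g ζ‖ < ε := by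
      intro w hw
      have hwD : w ∈ D.carrier := hrD (ball_subset_ball (by linarith) hw)
      refine hηε _ (subset_closure (hφm hwD)) ?_
      -- `h ∘ φ` is zero-free because the only zero `ζ` of `h` lies outside `D`.
      have := norm_pow_three_le_of_ne_zero (p := h ∘ φ) (c := z₀) (r := r) (A := A)
        (hh.2.comp (hφ.mono hrD) fun x hx => hφm (hrD hx))
        (fun x hx h0 => hζD ((hzero _ (subset_closure (hφm (hrD hx)))).1 h0 ▸ hφm (hrD hx)))
        (fun x hx => hA _ (hφm (hrD hx))) hw
      simp only [Function.comp_apply, hφz] at this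
      rw [lt_div_iff₀ (by positivity)] at hzη
      exact lt_of_pow_lt_pow_left₀ 3 hη.le (this.trans_lt hzη)
    have hr4 : 0 < r / 4 := by positivity
    have hsubr : ball z₀ (r / 4) ⊆ D.carrier := (ball_subset_ball (by linarith)).trans hrD
    have hF : DifferentiableOn ℂ (g ∘ φ) D.carrier := hg.2.comp hφ hφm
    have hDF : ‖fderiv ℂ (g ∘ φ) z₀‖ ≤ 2 * ε / (r / 4) := by
      have := norm_fderiv_le_of_norm_le_on_ball (f := fun w => (g ∘ φ) w - g ζ) hr4
        ((hF.mono hsubr).sub_const (g ζ)) fun w hw => (hball w hw).le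
      rwa [fderiv_sub_const] at this
    refine Q_le_of_norm_fderiv_le fun u => ?_
    rw [fderiv_extend_restrict g hzD]
    have hcomp : fderiv ℂ g z = (fderiv ℂ (g ∘ φ) z₀).comp (fderiv ℂ χ z) := by
      have h1 : g =ᶠ[𝓝 z] (g ∘ φ) ∘ χ := eventually_of_mem (D.isOpen.mem_nhds hzD)
        fun w hw => by simp [hφχ w hw]
      rw [h1.fderiv_eq, ← hχz]
      refine fderiv_comp z ?_ ((hχ z hzD).differentiableAt (D.isOpen.mem_nhds hzD))
      rw [hχz]
      exact (hF z₀ hz₀).differentiableAt (D.isOpen.mem_nhds hz₀)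
    rw [hcomp]
    calc ‖fderiv ℂ (g ∘ φ) z₀ (fderiv ℂ χ z u)‖
        ≤ ‖fderiv ℂ (g ∘ φ) z₀‖ * ‖fderiv ℂ χ z u‖ := ContinuousLinearMap.le_opNorm _ _
      _ ≤ 2 * ε / (r / 4) * (4 * M * √(bergmanMetric D.carrier z u u).re) :=
          mul_le_mul hDF (norm_fderiv_apply_le_of_bounded_map hχ (fun w hw => hM _ (hχm hw)) hzD u)
            (norm_nonneg _) (by positivity)
      _ = _ := by ring
  rw [ENNReal.tendsto_nhds_zero]
  intro a ha
  obtain ⟨b, hb0, hba⟩ : ∃ b : ℝ, 0 < b ∧ ENNReal.ofReal b ≤ a := by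
    obtain ⟨b, hb0, hba⟩ := ENNReal.lt_iff_exists_real_btwn.1 ha
    exact ⟨b, ENNReal.ofReal_pos.1 hba.1, hba.2.le⟩
  -- This `ε` solves `2ε / (r / 4) * 4M = b`.
  filter_upwards [key (b * r / (32 * M)) (by positivity)] with z hz
  refine hz.trans ((ENNReal.ofReal_le_ofReal (le_of_eq ?_)).trans hba)
  field_simp
  norm_num

theorem polynomialBloch_mem_starLittleBloch (hn : 1 ≤ n)
    (hpeak : ∀ ζ ∈ distinguishedBoundary D.carrier, ∃ h, MemDiskAlgebra D.carrier h ∧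
      ∀ z ∈ closure D.carrier, h z = 0 ↔ z = ζ) (i : Fin n) (P : Polynomial ℂ) :
    polynomialBloch z₀ i P ∈ starLittleBloch D z₀ := by
  have hd : Differentiable ℂ fun w : Fin n → ℂ => P.eval (w i) :=
    P.differentiable.comp (differentiable_apply i)
  change Tendsto (D.Q fun w => P.eval (w.1 i)) (𝓝ˢ (distinguishedBoundary D.carrier) ⊓ 𝓟 D.carrier)
    (𝓝 0)
  -- The neighbourhood filter of a set is the supremum of those of its points, so a limit at each
  -- `ζ` suffices, with no uniformity in `ζ`.
  rw [nhdsSet, sSup_image]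
  simp_rw [← iSup_inf_principal]
  refine tendsto_iSup.2 fun ζ => tendsto_iSup.2 fun hζ => ?_
  obtain ⟨h, hh, hzero⟩ := hpeak ζ hζ
  exact tendsto_Q_restrict (distinguishedBoundary_subset_frontier hn D.isConnected.nonempty
    D.isBounded hζ) hh hzero (g := fun w => P.eval (w i))
    ⟨hd.continuous.continuousOn, hd.differentiableOn⟩

end BoundedHomogeneousDomain

theorem mainTheorem4 {n : ℕ} (hn : 1 ≤ n) (D : BoundedHomogeneousDomain n) (z₀ : D.carrier) :
    (∀ ψ : D.carrier → ℂ, D.Holo ψ →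
      (BoundedHomogeneousDomain.IsCompactMultiplication ψ (⊤ : Submodule ℂ (D.BlochSpace z₀)) ↔
        ψ = 0)) ∧
    (¬ FiniteDimensional ℂ (D.starLittleBloch z₀) →
      ∀ ψ : D.carrier → ℂ, D.Holo ψ →
        (BoundedHomogeneousDomain.IsCompactMultiplication ψ (D.starLittleBloch z₀) ↔ ψ = 0)) ∧
    ((∀ ζ ∈ distinguishedBoundary D.carrier, ∃ h, MemDiskAlgebra D.carrier h ∧
        ∀ z ∈ closure D.carrier, h z = 0 ↔ z = ζ) →
      ¬ FiniteDimensional ℂ (D.starLittleBloch z₀)) := by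
  let i : Fin n := ⟨0, hn⟩
  refine ⟨fun ψ hψ => ⟨fun h => ?_, ?_⟩, fun hX ψ hψ => ⟨fun h => ?_, ?_⟩, fun hpeak => ?_⟩
  · exact h.eq_zero hψ ⟨_, Submodule.mem_top, BoundedHomogeneousDomain.polynomialBloch_one i⟩
      (BoundedHomogeneousDomain.not_finiteDimensional_of_polynomialBloch_mem i
        fun P => Submodule.mem_top)
  · rintro rfl
    exact BoundedHomogeneousDomain.isCompactMultiplication_zero _
  · exact h.eq_zero hψ (BoundedHomogeneousDomain.exists_mem_starLittleBloch_eq_one i) hX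
  · rintro rfl
    exact BoundedHomogeneousDomain.isCompactMultiplication_zero _
  · exact BoundedHomogeneousDomain.not_finiteDimensional_of_polynomialBloch_mem i
      (BoundedHomogeneousDomain.polynomialBloch_mem_starLittleBloch hn hpeak i)
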